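/- Let $c,\lambda,t>0$, let $d\ge 1$, $l\ge 0$, $n\ge 1$ be integers, and let $m\in\{0,1\}$. Let $N$ be a homogeneous Poisson process of rate $\lambda$ with event times $0=s_0<s_1<s_2<\cdots$, and let $\theta_1,\theta_2,\dots$ be i.i.d. random variables, independent of $N$, with density $\frac{\Gamma(m+1)}{\sqrt\pi\,\Gamma(m+\frac12)}\sin^{2m}\theta$ on $(0,\pi)$. Consider the random motion on the line $$X_m(s)=c\Big(\sum_{j=1}^{N(s)}(s_j-s_{j-1})\cos\theta_j+(s-s_{N(s)})\cos\theta_{N(s)+1}\Big),\qquad s\ge 0 .$$ Let $R_1^d,\dots,R_{l+1}^d$ be independent $d$-dimensional Bessel processes started at $0$, i.e. $R_j^d(s)=\sqrt{\sum_{i=1}^d B_{j,i}(s)^2}$ with independent standard Brownian motions $B_{j,i}$ that are jointly independent of $N$ and of the $\theta_j$, and let $T=\mathcal R_l^d(t)=R_1^d(R_2^d(\cdots(R_{l+1}^d(t))\cdots))$ be the $l$-times iterated Bessel process at time $t$. Put $v_0=\frac n2$, $v_1=n+1$, and assume $v_m>\frac d2-1$. The law of $X_m(T)$ for a fixed number $n$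 of Poisson events up to the random time, that is, the probability measure $$\mu_n(A)=\int_0^\infty P\{X_m(T)\in A\mid N(T)=n,\ T=s\}\,P\{T\in ds\},$$ is absolutely continuous on $\mathbb R$, with density at $x$ equal to $$\frac{1}{B\left(\frac d2,v_m-\frac d2+1\right)}\,\frac{1}{\left(\Gamma(\frac d2)2^{\frac d2-1}\right)^l}\int_0^\infty\!\!\cdots\!\int_0^\infty\Big(\prod_{j=1}^{l}\frac{t_j^{d-1}e^{-t_j^2/(2t_{j+1})}}{t_{j+1}^{d/2}}\Big)\left[\int_0^1 w^{\frac d2-1}(1-w)^{v_m-\frac d2}\,\frac{e^{-x^2/(2c^2t_1w)}}{\sqrt{2\pi t_1w}\,c}\,dw\right]dt_1\cdots dt_l,$$ where $t_{l+1}=t$ and $B(a,b)=\Gamma(a)\Gamma(b)/\Gamma(a+b)$ (for $l=0$ there is no integration over the $t_j$, and $t_1=t$). The value of the density at the single point $x=0$, which may be $+\infty$, is immaterial. -/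

import Mathlib

open MeasureTheory ProbabilityTheory
open scoped NNReal ENNReal

noncomputable section

/-- The law on `(0, π)` with density `Γ(ν+1) / (√π Γ(ν+1/2)) * sin^{2ν} θ`. -/
def angleMeasure (ν : ℝ) : Measure ℝ :=
  (volume.restrict (Set.Ioo 0 Real.pi)).withDensity fun θ =>
    ENNReal.ofReal
      (Real.Gamma (ν + 1) / (√Real.pi * Real.Gamma (ν + 1 / 2)) * Real.sin θ ^ (2 * ν))

section Motion

variable {Ω : Type*}

/-- The time of occurrence `s_j = τ_0 + ... + τ_{j-1}` of the `j`-th event (`s_0 = 0`) when the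
successive waiting times are `τ_0, τ_1, ...`. -/
def epoch (τ : ℕ → Ω → ℝ) (j : ℕ) (ω : Ω) : ℝ :=
  ∑ i ∈ Finset.range j, τ i ω

/-- `N(s)`: the number of events that occur up to time `s`. It is the homogeneous Poisson process
of rate `r` when the waiting times are independent and exponential of rate `r`. -/
def eventCount (τ : ℕ → Ω → ℝ) (s : ℝ) (ω : Ω) : ℕ :=
  Set.ncard {j : ℕ | 1 ≤ j ∧ epoch τ j ω ≤ s}

/-- The position `X(s) = c ∑_{j=1}^{N(s)+1} (s_j - s_{j-1}) cos θ_j`, where the last epoch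
`s_{N(s)+1}` is replaced by `s`. The angles are numbered from `0`. -/
def position (c : ℝ) (τ θ : ℕ → Ω → ℝ) (s : ℝ) (ω : Ω) : ℝ :=
  c * (∑ j ∈ Finset.range (eventCount τ s ω),
        (epoch τ (j + 1) ω - epoch τ j ω) * Real.cos (θ j ω)
      + (s - epoch τ (eventCount τ s ω) ω) * Real.cos (θ (eventCount τ s ω) ω))

/-- The Bessel process `R(s) = √(∑ B_i(s)^2)` of a `d`-tuple of processes. -/
def bessel {d : ℕ} (B : Fin d → ℝ≥0 → Ω → ℝ) (s : ℝ≥0) (ω : Ω) : ℝ≥0 :=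
  ⟨√(∑ i, B i s ω ^ 2), Real.sqrt_nonneg _⟩

/-- The iterated Bessel process `R_1(R_2(...(R_{l+1}(t))...))`. -/
def iteratedBessel {d : ℕ} : (l : ℕ) → (Fin (l + 1) → Fin d → ℝ≥0 → Ω → ℝ) → ℝ≥0 → Ω → ℝ≥0
  | 0, B, t, ω => bessel (B 0) t ω
  | l + 1, B, t, ω => bessel (B 0) (iteratedBessel l (fun j => B j.succ) t ω) ω

/-- The law of the motion at the random time `T` for a fixed number `n` of events up to time `T`:
`∫ P{X(T) ∈ dx | N(T) = n, T = s} P{T ∈ ds}`. -/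
def lawFixedCount [MeasurableSpace Ω] (P : Measure Ω) [IsFiniteMeasure P]
    (c : ℝ) (τ θ : ℕ → Ω → ℝ) (T : Ω → ℝ≥0) (n : ℕ) : Measure ℝ :=
  (P.map T).bind fun s =>
    condDistrib (fun ω => position c τ θ (T ω) ω) (fun ω => (eventCount τ (T ω) ω, T ω)) P (n, s)

end Motion

/-- `v_0 = n / 2` and `v_1 = n + 1`. -/
def vParam (m : Fin 2) (n : ℕ) : ℝ :=
  if m = 0 then (n : ℝ) / 2 else (n : ℝ) + 1

/-- The inner integral over `w`, as a function of `t_1`. -/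
def betaGaussIntegral (d : ℕ) (v c x t₁ : ℝ) : ℝ≥0∞ :=
  ∫⁻ w in Set.Ioo (0 : ℝ) 1, ENNReal.ofReal
    (w ^ ((d : ℝ) / 2 - 1) * (1 - w) ^ (v - (d : ℝ) / 2) *
      (Real.exp (-x ^ 2 / (2 * c ^ 2 * t₁ * w)) / (√(2 * Real.pi * t₁ * w) * c)))

/-- The `l`-fold integral over `t_1, ..., t_l > 0` of
`∏ j, t_j ^ (d-1) exp (-t_j ^ 2 / (2 t_{j+1})) / t_{j+1} ^ (d/2)` times `g t_1`, where
`t_{l+1} = t`; the integration in `t_l` is the outermost one, and the value is `g t` for `l = 0`. -/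
def nestedIntegral (d : ℕ) (g : ℝ → ℝ≥0∞) : ℕ → ℝ → ℝ≥0∞
  | 0, t => g t
  | l + 1, t => ∫⁻ s in Set.Ioi (0 : ℝ),
      ENNReal.ofReal
        (s ^ ((d : ℝ) - 1) * Real.exp (-s ^ 2 / (2 * t)) / t ^ ((d : ℝ) / 2)) *
      nestedIntegral d g l s

end

/-! Given `n` events up to time `s`, the position is `s * Y`, where `Y` has law `unitLaw c α n`;
this is a renewal argument at the first event (`lintegral_linePosition`). The moments of `Y` are, up
to factorials, the coefficients of `M ^ (n + 1)`, where `M` is the ordinary generating series of the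
moments of `cos θ` (`integral_pow_unitLaw`): the weights `s_j - s_{j-1}` are Dirichlet distributed,
and their mixed moments cancel the multinomial coefficients. For `m = 0` the cosine is arcsine
distributed and `M = (1 - z²)^(-1/2)`; for `m = 1` it is semicircular and `z² M² = 4 (M - 1)`. In
both cases the powers of `M` have two-term recursions, and `E Y^(k+2) = c² (k + 1) / (k + 2 v_m + 2)
* E Y^k` (`unitLaw_moments`).

A Bessel variable `R` at time `t` satisfies `E R^(k+2) = t (d + k) E R^k`. Hence `R * Y` has the
same moments as `c √t √W Z`, with `W` of law Beta(`d/2`, `v_m - d/2 + 1`) and `Z` an independent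
standard Gaussian; the condition on `v_m` makes the second parameter positive. Both products have
all exponential moments, so their laws agree (`besselLaw_mul_unitLaw`). Conditioning on `W` produces
the bracket of the formula, `betaGaussIntegral`.

For the iterated clock, each outer process is independent of its own clock, so the law of `T` is an
`l`-fold integral of Bessel densities ending in one more Bessel law at time `t_1`
(`lintegral_iteratedBessel`). That last law is absorbed by the product identity, which leaves `l`
integrals and `l` normalizing factors.

Two measure-theoretic points remain. Composition of processes is handled by a functional `clock`
that is measurable on path space and agrees almost surely with the iterated process. The conditional
law is determined only almost everywhere for the law of `(N(T), T)`; since every Poisson weight is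
positive at positive times, it is nevertheless determined for each fixed `n` and almost every value
of `T` (`condDistrib_position_ae_eq`). -/

noncomputable section

/-! ### Splitting off the first term of an i.i.d. sequence -/

/-- Prepending an independent value to an i.i.d. sequence gives an i.i.d. sequence. -/
lemma measurePreserving_cons_infinitePi {X : Type*} [MeasurableSpace X] (μ : Measure X)
    [IsProbabilityMeasure μ] :
    MeasurePreserving
      (fun p : X × (ℕ → X) => fun k : ℕ => Nat.casesOn (motive := fun _ => X) k p.1 p.2)
      (μ.prod (Measure.infinitePi fun _ : ℕ => μ)) (Measure.infinitePi fun _ : ℕ => μ) := by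
  have hm : Measurable
      (fun p : X × (ℕ → X) => fun k : ℕ => Nat.casesOn (motive := fun _ => X) k p.1 p.2) := by
    refine measurable_pi_lambda _ fun k => ?_
    cases k with
    | zero => exact measurable_fst
    | succ k => exact (measurable_pi_apply k).comp measurable_snd
  refine ⟨hm, Measure.eq_infinitePi _ fun s t ht => ?_⟩
  classical
  rw [Measure.map_apply hm (MeasurableSet.pi s.countable_toSet fun i _ => ht i)]
  -- The preimage of a cylinder is a rectangle: position `k` of the tail carries the constraint of
  -- position `k + 1`, whence the predecessors of the nonzero indices.
  have key : (fun p : X × (ℕ → X) => fun k : ℕ => Nat.casesOn (motive := fun _ => X) k p.1 p.2) ⁻¹'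
      (Set.pi s t) = (if 0 ∈ s then t 0 else Set.univ) ×ˢ
        Set.pi ((s.erase 0).image Nat.pred : Finset ℕ) (fun k => t (k + 1)) := by
    ext ⟨u, x⟩
    simp only [Set.mem_preimage, Set.mem_pi, Finset.mem_coe, Set.mem_prod, Finset.mem_image,
      Finset.mem_erase]
    constructor
    · intro h
      refine ⟨?_, ?_⟩
      · split_ifs with h0
        · exact h 0 h0
        · trivial
      · rintro k ⟨j, ⟨hj0, hj⟩, rfl⟩
        obtain ⟨j, rfl⟩ := Nat.exists_eq_succ_of_ne_zero hj0
        exact h _ hj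
    · rintro ⟨h0, h⟩ k hk
      cases k with
      | zero => simpa [hk] using h0
      | succ k => exact h k ⟨k + 1, ⟨by simp, hk⟩, rfl⟩
  rw [key, Measure.prod_prod, Measure.infinitePi_pi _ (fun i _ => ht _), Finset.prod_image]
  · have : ∏ x ∈ s.erase 0, μ (t (x.pred + 1)) = ∏ x ∈ s.erase 0, μ (t x) := by
      refine Finset.prod_congr rfl fun x hx => ?_
      rw [Nat.pred_eq_sub_one, Nat.sub_add_cancel (Nat.pos_of_ne_zero (Finset.ne_of_mem_erase hx))]
    rw [this]
    split_ifs with h0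
    · exact Finset.mul_prod_erase s (fun i => μ (t i)) h0
    · rw [measure_univ, one_mul, Finset.erase_eq_of_notMem h0]
  · intro a ha b hb hab
    have h1 := Finset.ne_of_mem_erase ha
    have h2 := Finset.ne_of_mem_erase hb
    simp only [Nat.pred_eq_sub_one] at hab
    omega

/-- The sequence `u, x 0, x 1, ...`. -/
def consSeq {X : Type*} (u : X) (x : ℕ → X) : ℕ → X :=
  fun k => Nat.casesOn (motive := fun _ => X) k u x

@[simp] lemma consSeq_zero {X : Type*} (u : X) (x : ℕ → X) : consSeq u x 0 = u := rfl

@[simp] lemma consSeq_succ {X : Type*} (u : X) (x : ℕ → X) (k : ℕ) :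
    consSeq u x (k + 1) = x k := rfl

lemma lintegral_infinitePi_cons {X : Type*} [MeasurableSpace X] (μ : Measure X)
    [IsProbabilityMeasure μ] {f : (ℕ → X) → ℝ≥0∞} (hf : Measurable f) :
    ∫⁻ x, f x ∂(Measure.infinitePi fun _ : ℕ => μ) =
      ∫⁻ u, ∫⁻ x, f (consSeq u x) ∂(Measure.infinitePi fun _ : ℕ => μ) ∂μ := by
  have h := measurePreserving_cons_infinitePi μ
  rw [← h.lintegral_comp hf]
  exact lintegral_prod _ (hf.comp h.measurable).aemeasurable

/-! ### The motion at a fixed time for a given number of events -/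

/-- The law on `(0, 1)` with density `(n + 1) (1 - w) ^ n`. -/
def headLaw (n : ℕ) : Measure ℝ :=
  (volume.restrict (Set.Ioo 0 1)).withDensity fun w => ENNReal.ofReal ((n + 1) * (1 - w) ^ n)

lemma lintegral_headLaw (n : ℕ) {f : ℝ → ℝ≥0∞} (hf : Measurable f) :
    ∫⁻ w, f w ∂headLaw n =
      ∫⁻ w in Set.Ioo (0 : ℝ) 1, ENNReal.ofReal ((n + 1) * (1 - w) ^ n) * f w := by
  rw [headLaw, lintegral_withDensity_eq_lintegral_mul _ (by fun_prop) hf]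
  rfl

instance isProbabilityMeasure_headLaw (n : ℕ) : IsProbabilityMeasure (headLaw n) := by
  constructor
  rw [headLaw, withDensity_apply _ MeasurableSet.univ, Measure.restrict_univ,
    ← ofReal_integral_eq_lintegral_ofReal]
  · rw [← integral_Ioc_eq_integral_Ioo, ← intervalIntegral.integral_of_le zero_le_one]
    have := intervalIntegral.integral_comp_sub_left (fun w : ℝ => ((n : ℝ) + 1) * w ^ n) (1 : ℝ)
      (a := 0) (b := 1)
    rw [this]
    rw [intervalIntegral.integral_const_mul, integral_pow]
    have : (n : ℝ) + 1 ≠ 0 := by positivity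
    simp [this]
  · have : IntegrableOn (fun w : ℝ => ((n : ℝ) + 1) * (1 - w) ^ n) (Set.Icc 0 1) :=
      Continuous.integrableOn_Icc (by fun_prop)
    exact this.mono_set Set.Ioo_subset_Icc_self
  · refine (ae_restrict_iff' measurableSet_Ioo).2 (Filter.Eventually.of_forall fun w hw => ?_)
    have : 0 ≤ 1 - w := by linarith [hw.2]
    simp only [Pi.zero_apply]
    positivity

/-- The law of the motion at time `1`, given `n` changes of direction before time `1`, when the
directions have angles distributed according to `α`. -/
def unitLaw (c : ℝ) (α : Measure ℝ) : ℕ → Measure ℝ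
  | 0 => α.map fun a => c * Real.cos a
  | n + 1 => ((headLaw n).prod (α.prod (unitLaw c α n))).map
      fun p => c * p.1 * Real.cos p.2.1 + (1 - p.1) * p.2.2

instance isProbabilityMeasure_unitLaw (c : ℝ) (α : Measure ℝ) [IsProbabilityMeasure α] (n : ℕ) :
    IsProbabilityMeasure (unitLaw c α n) := by
  induction n with
  | zero => exact Measure.isProbabilityMeasure_map (by fun_prop)
  | succ n ih => exact Measure.isProbabilityMeasure_map (by fun_prop)

lemma lintegral_unitLaw_succ (c : ℝ) (α : Measure ℝ) [IsProbabilityMeasure α] (n : ℕ)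
    {f : ℝ → ℝ≥0∞} (hf : Measurable f) :
    ∫⁻ y, f y ∂unitLaw c α (n + 1) = ∫⁻ w in Set.Ioo (0 : ℝ) 1,
      ENNReal.ofReal ((n + 1) * (1 - w) ^ n) *
        ∫⁻ a, ∫⁻ y, f (c * w * Real.cos a + (1 - w) * y) ∂unitLaw c α n ∂α := by
  rw [unitLaw, lintegral_map hf (by fun_prop), lintegral_prod _ (by fun_prop),
    lintegral_headLaw _ (by fun_prop)]
  refine lintegral_congr fun w => ?_
  rw [lintegral_prod _ (by fun_prop)]

/-- The position at time `s` when exactly `n` events have occurred. -/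
def linePosition (c : ℝ) (n : ℕ) (s : ℝ) (x y : ℕ → ℝ) : ℝ :=
  c * (∑ j ∈ Finset.range n, x j * Real.cos (y j)
    + (s - ∑ i ∈ Finset.range n, x i) * Real.cos (y n))

/-- The waiting times for which exactly `n` events have occurred at time `s`. -/
def countSet (n : ℕ) (s : ℝ) : Set (ℕ → ℝ) :=
  {x | ∑ i ∈ Finset.range n, x i ≤ s ∧ s < ∑ i ∈ Finset.range (n + 1), x i}

/-- The Poisson probabilities at time `s`. -/
def poissonWeight (r : ℝ) (n : ℕ) (s : ℝ) : ℝ :=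
  if 0 ≤ s then Real.exp (-(r * s)) * (r * s) ^ n / n.factorial else 0

@[fun_prop]
lemma measurable_poissonWeight (r : ℝ) (n : ℕ) : Measurable (poissonWeight r n) :=
  Measurable.ite measurableSet_Ici (by fun_prop) (by fun_prop)

lemma measurableSet_countSet_uncurry (n : ℕ) :
    MeasurableSet {p : ℝ × (ℕ → ℝ) | p.2 ∈ countSet n p.1} := by
  have h (k : ℕ) : Measurable fun p : ℝ × (ℕ → ℝ) => ∑ i ∈ Finset.range k, p.2 i := by fun_prop
  exact (measurableSet_le (h n) measurable_fst).inter (measurableSet_lt measurable_fst (h (n + 1)))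

@[fun_prop]
lemma measurable_linePosition {Z : Type*} [MeasurableSpace Z] (c : ℝ) (n : ℕ) {s : Z → ℝ}
    {x y : Z → ℕ → ℝ} (hs : Measurable s) (hx : Measurable x) (hy : Measurable y) :
    Measurable fun z => linePosition c n (s z) (x z) (y z) := by
  unfold linePosition
  fun_prop

/-- Renewal: after the first event the motion restarts with the remaining time `s - u`. -/
lemma linePosition_cons (c : ℝ) (n : ℕ) (s u a : ℝ) (x y : ℕ → ℝ) :
    linePosition c (n + 1) s (consSeq u x) (consSeq a y) =
      c * u * Real.cos a + linePosition c n (s - u) x y := by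
  simp only [linePosition, Finset.sum_range_succ', consSeq_zero, consSeq_succ]
  ring

lemma cons_mem_countSet (n : ℕ) (s u : ℝ) (x : ℕ → ℝ) :
    consSeq u x ∈ countSet (n + 1) s ↔ x ∈ countSet n (s - u) := by
  simp only [countSet, Set.mem_ofPred_eq, Finset.sum_range_succ' _ (n + 1),
    Finset.sum_range_succ' _ n, consSeq_zero, consSeq_succ]
  constructor <;> rintro ⟨h1, h2⟩ <;> constructor <;> linarith

lemma lintegral_expMeasure (r : ℝ) {f : ℝ → ℝ≥0∞} (hf : Measurable f) :
    ∫⁻ u, f u ∂expMeasure r = ∫⁻ u, exponentialPDF r u * f u := by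
  have : expMeasure r = volume.withDensity (exponentialPDF r) := rfl
  have hm : Measurable (exponentialPDF r) := by
    unfold exponentialPDF; fun_prop
  rw [this, lintegral_withDensity_eq_lintegral_mul _ hm hf]
  rfl

lemma expMeasure_Ioi {r : ℝ} (hr : 0 < r) {s : ℝ} (hs : 0 ≤ s) :
    expMeasure r (Set.Ioi s) = ENNReal.ofReal (Real.exp (-(r * s))) := by
  have := isProbabilityMeasure_expMeasure hr
  have h := cdf_expMeasure_eq hr s
  rw [cdf_eq_real, if_pos hs] at h
  rw [← Set.compl_Iic, ← ofReal_measureReal, measureReal_compl measurableSet_Iic, h]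
  simp

lemma setLIntegral_Ioo_mul {s : ℝ} (hs : 0 < s) {g : ℝ → ℝ≥0∞} (hg : Measurable g) :
    ∫⁻ u in Set.Ioo 0 s, g u = ENNReal.ofReal s * ∫⁻ w in Set.Ioo (0 : ℝ) 1, g (s * w) := by
  have h := Real.smul_map_volume_mul_left hs.ne'
  have h2 : ∫⁻ u in Set.Ioo 0 s, g u = ∫⁻ u, (Set.Ioo 0 s).indicator g u := by
    rw [lintegral_indicator measurableSet_Ioo]
  rw [h2]
  conv_lhs => rw [← h]
  rw [lintegral_smul_measure, lintegral_map (hg.indicator measurableSet_Ioo) (by fun_prop),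
    abs_of_pos hs, smul_eq_mul,
    ← lintegral_indicator measurableSet_Ioo]
  congr 1
  refine lintegral_congr fun w => ?_
  simp only [Set.indicator, Set.mem_Ioo, mul_pos_iff_of_pos_left hs, mul_lt_iff_lt_one_right hs]

/-- Given `n + 1` events up to `s`, the first epoch is `s` times a variable of law `headLaw n`. The
exponentials in `u` and `s - u` multiply to `exp (-(r * s))`, the substitution `u = s * w` gives the
polynomial density, and the vanishing of `poissonWeight` at negative times restricts `u` to `[0,
s]`. -/
lemma lintegral_expMeasure_poissonWeight {r : ℝ} (hr : 0 < r) (n : ℕ) (s : ℝ)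
    {g : ℝ → ℝ≥0∞} (hg : Measurable g) :
    ∫⁻ u, ENNReal.ofReal (poissonWeight r n (s - u)) * g u ∂expMeasure r =
      ENNReal.ofReal (poissonWeight r (n + 1) s) *
        ∫⁻ w in Set.Ioo (0 : ℝ) 1, ENNReal.ofReal ((n + 1) * (1 - w) ^ n) * g (s * w) := by
  have hlhs : ∫⁻ u, ENNReal.ofReal (poissonWeight r n (s - u)) * g u ∂expMeasure r =
      ∫⁻ u in Set.Ioo 0 s, ENNReal.ofReal
        (r * Real.exp (-(r * s)) * (r * (s - u)) ^ n / n.factorial) * g u := by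
    rw [lintegral_expMeasure _ (by fun_prop), setLIntegral_congr Ioo_ae_eq_Icc,
      ← lintegral_indicator measurableSet_Icc]
    refine lintegral_congr fun u => ?_
    by_cases hu : u ∈ Set.Icc 0 s
    · rw [Set.indicator_of_mem hu, exponentialPDF_of_nonneg hu.1, poissonWeight,
        if_pos (sub_nonneg.2 hu.2), ← mul_assoc, ← ENNReal.ofReal_mul (by positivity)]
      congr 2
      have : Real.exp (-(r * s)) = Real.exp (-(r * u)) * Real.exp (-(r * (s - u))) := by
        rw [← Real.exp_add]; ring_nf
      rw [this]
      ring
    · rw [Set.indicator_of_notMem hu]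
      rw [Set.mem_Icc, not_and_or, not_le, not_le] at hu
      rcases hu with hu | hu
      · rw [exponentialPDF_of_neg hu, zero_mul]
      · rw [poissonWeight, if_neg (by linarith), ENNReal.ofReal_zero, zero_mul, mul_zero]
  rw [hlhs]
  -- For `s ≤ 0` both sides vanish; at `s = 0` this is because the exponent `n + 1` is positive.
  rcases le_or_gt s 0 with hs | hs
  · rw [Set.Ioo_eq_empty (not_lt.2 hs), Measure.restrict_empty, lintegral_zero_measure,
      poissonWeight]
    split_ifs with h
    · have : s = 0 := le_antisymm hs h
      simp [this]
    · simp
  · rw [setLIntegral_Ioo_mul hs (by fun_prop), ← lintegral_const_mul _ (by fun_prop),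
      ← lintegral_const_mul _ (by fun_prop)]
    refine setLIntegral_congr_fun measurableSet_Ioo fun w hw => ?_
    have hw' : 0 ≤ 1 - w := by linarith [hw.2]
    rw [← mul_assoc, ← mul_assoc, ← ENNReal.ofReal_mul hs.le, poissonWeight, if_pos hs.le,
      ← ENNReal.ofReal_mul (by positivity)]
    congr 2
    rw [show r * (s - s * w) = r * s * (1 - w) by ring, Nat.factorial_succ]
    push_cast
    generalize 1 - w = q
    field_simp
    ring

/-- Conditionally on the occurrence of exactly `n` events up to time `s`, the position at time `s`
is distributed as `s` times a variable with law `unitLaw c α n`. -/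
theorem lintegral_linePosition (c : ℝ) {r : ℝ} (hr : 0 < r) (α : Measure ℝ)
    [IsProbabilityMeasure α] (n : ℕ) (s : ℝ) {f : ℝ → ℝ≥0∞} (hf : Measurable f) :
    ∫⁻ x, ∫⁻ y, (countSet n s).indicator (fun x => f (linePosition c n s x y)) x
        ∂(Measure.infinitePi fun _ : ℕ => α) ∂(Measure.infinitePi fun _ : ℕ => expMeasure r) =
      ENNReal.ofReal (poissonWeight r n s) * ∫⁻ y, f (s * y) ∂unitLaw c α n := by
  have := isProbabilityMeasure_expMeasure hr
  have hms (n : ℕ) (s : ℝ) : MeasurableSet (countSet n s) :=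
    (measurableSet_countSet_uncurry n).preimage (measurable_prodMk_left (x := s))
  have hmG (n : ℕ) (s : ℝ) {f : ℝ → ℝ≥0∞} (hf : Measurable f) :
      Measurable fun p : (ℕ → ℝ) × (ℕ → ℝ) =>
        (countSet n s).indicator (fun x => f (linePosition c n s x p.2)) p.1 := by
    have : (fun p : (ℕ → ℝ) × (ℕ → ℝ) =>
        (countSet n s).indicator (fun x => f (linePosition c n s x p.2)) p.1) =
        (Prod.fst ⁻¹' countSet n s).indicator fun p => f (linePosition c n s p.1 p.2) := rfl
    rw [this]
    refine Measurable.indicator (hf.comp ?_) (measurable_fst (hms n s))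
    exact measurable_linePosition c n measurable_const measurable_fst measurable_snd
  induction n generalizing s f with
  | zero =>
    have h1 (x : ℕ → ℝ) : ∫⁻ y, (countSet 0 s).indicator (fun x => f (linePosition c 0 s x y)) x
        ∂(Measure.infinitePi fun _ : ℕ => α) =
        (countSet 0 s).indicator (fun _ => ∫⁻ y, f (s * y) ∂unitLaw c α 0) x := by
      by_cases hx : x ∈ countSet 0 s
      · simp only [Set.indicator_of_mem hx]
        rw [unitLaw, lintegral_map (by fun_prop) (by fun_prop),
          ← (measurePreserving_eval_infinitePi (fun _ : ℕ => α) 0).lintegral_comp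
            (f := fun a => f (s * (c * Real.cos a))) (by fun_prop)]
        refine lintegral_congr fun y => ?_
        simp only [linePosition, Finset.sum_range_zero, Function.eval]
        congr 1
        ring
      · simp [Set.indicator_of_notMem hx]
    simp_rw [h1]
    rw [lintegral_indicator (hms 0 s), setLIntegral_const, mul_comm]
    congr 1
    rcases lt_or_ge s 0 with hs | hs
    · have : countSet 0 s = ∅ := by
        ext x
        simp [countSet, hs]
      rw [this, measure_empty, poissonWeight, if_neg (not_le.2 hs), ENNReal.ofReal_zero]
    · have : countSet 0 s = Function.eval 0 ⁻¹' Set.Ioi s := by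
        ext x
        simp [countSet, hs]
      rw [this, (measurePreserving_eval_infinitePi (fun _ : ℕ => expMeasure r) 0).measure_preimage
        measurableSet_Ioi.nullMeasurableSet, expMeasure_Ioi hr hs, poissonWeight, if_pos hs]
      simp
  | succ n ih =>
    have hG := hmG (n + 1) s hf
    rw [lintegral_infinitePi_cons _ hG.lintegral_prod_right']
    have h1 (u : ℝ) :
        ∫⁻ x, ∫⁻ y, (countSet (n + 1) s).indicator
            (fun x => f (linePosition c (n + 1) s x y)) (consSeq u x)
          ∂(Measure.infinitePi fun _ : ℕ => α) ∂(Measure.infinitePi fun _ : ℕ => expMeasure r) =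
        ENNReal.ofReal (poissonWeight r n (s - u)) *
          ∫⁻ a, ∫⁻ y, f (c * u * Real.cos a + (s - u) * y) ∂unitLaw c α n ∂α := by
      have h2 (x : ℕ → ℝ) : ∫⁻ y, (countSet (n + 1) s).indicator
            (fun x => f (linePosition c (n + 1) s x y)) (consSeq u x)
          ∂(Measure.infinitePi fun _ : ℕ => α) =
          ∫⁻ a, ∫⁻ y, (countSet n (s - u)).indicator
            (fun x => f (c * u * Real.cos a + linePosition c n (s - u) x y)) x
            ∂(Measure.infinitePi fun _ : ℕ => α) ∂α := by
        have hGx : Measurable fun y : ℕ → ℝ => (countSet (n + 1) s).indicator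
            (fun x => f (linePosition c (n + 1) s x y)) (consSeq u x) :=
          hG.comp measurable_prodMk_left
        rw [lintegral_infinitePi_cons _ hGx]
        refine lintegral_congr fun a => lintegral_congr fun y => ?_
        by_cases hx : x ∈ countSet n (s - u)
        · rw [Set.indicator_of_mem hx, Set.indicator_of_mem ((cons_mem_countSet n s u x).2 hx),
            linePosition_cons]
        · rw [Set.indicator_of_notMem hx,
            Set.indicator_of_notMem (mt (cons_mem_countSet n s u x).1 hx)]
      simp_rw [h2]
      rw [lintegral_lintegral_swap, ← lintegral_const_mul _ (by fun_prop)]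
      · refine lintegral_congr fun a => ?_
        exact ih (s - u) (f := fun z => f (c * u * Real.cos a + z)) (by fun_prop)
      · refine Measurable.aemeasurable ?_
        refine Measurable.lintegral_prod_right' (f := fun q : ((ℕ → ℝ) × ℝ) × (ℕ → ℝ) =>
          (countSet n (s - u)).indicator
            (fun x => f (c * u * Real.cos q.1.2 + linePosition c n (s - u) x q.2)) q.1.1) ?_
        have : (fun q : ((ℕ → ℝ) × ℝ) × (ℕ → ℝ) => (countSet n (s - u)).indicator
            (fun x => f (c * u * Real.cos q.1.2 + linePosition c n (s - u) x q.2)) q.1.1) =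
          ((fun q : ((ℕ → ℝ) × ℝ) × (ℕ → ℝ) => q.1.1) ⁻¹' countSet n (s - u)).indicator
            fun q => f (c * u * Real.cos q.1.2 + linePosition c n (s - u) q.1.1 q.2) := rfl
        rw [this]
        exact Measurable.indicator (by fun_prop) ((by fun_prop : Measurable _) (hms n (s - u)))
    simp_rw [h1]
    rw [lintegral_expMeasure_poissonWeight hr, lintegral_unitLaw_succ _ _ _ (by fun_prop)]
    · congr 1
      refine lintegral_congr fun w => ?_
      congr 1
      refine lintegral_congr fun a => lintegral_congr fun y => ?_
      congr 1
      ring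
    · fun_prop

/-! ### Powers of the arcsine and semicircle moment series -/

section PowerSeriesRecursions

open PowerSeries

lemma coeff_X_mul_derivative (F : ℝ⟦X⟧) (k : ℕ) :
    coeff k (X * derivative ℝ F) = k * coeff k F := by
  cases k with
  | zero => simp
  | succ k =>
    rw [coeff_succ_X_mul, coeff_derivative]
    push_cast
    ring

lemma coeff_X_sq_mul (F : ℝ⟦X⟧) (k : ℕ) : coeff (k + 2) (X ^ 2 * F) = coeff k F := by
  rw [coeff_X_pow_mul]

lemma coeff_zero_X_sq_mul (F : ℝ⟦X⟧) : coeff 0 (X ^ 2 * F) = 0 := by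
  simp

lemma coeff_one_X_sq_mul (F : ℝ⟦X⟧) : coeff 1 (X ^ 2 * F) = 0 := by
  rw [coeff_X_pow_mul', if_neg (by norm_num)]

/-- With `M = mk a`, the recursion is the equation `z (1 - z²) M' = z² M`. The chain rule gives `z
(1 - z²) (M^p)' = p z² M^p`, and comparing coefficients finishes. -/
lemma coeff_pow_of_arcsine_recursion (a : ℕ → ℝ) (h0 : a 0 = 1) (h1 : a 1 = 0)
    (hrec : ∀ k : ℕ, ((k : ℝ) + 2) * a (k + 2) = (k + 1) * a k) (p : ℕ) :
    coeff 0 (mk a ^ p) = 1 ∧ coeff 1 (mk a ^ p) = 0 ∧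
      ∀ k : ℕ, ((k : ℝ) + 2) * coeff (k + 2) (mk a ^ p) = (k + p) * coeff k (mk a ^ p) := by
  have hM : X * derivative ℝ (mk a) - X ^ 2 * (X * derivative ℝ (mk a)) = X ^ 2 * mk a := by
    ext k
    rw [map_sub, coeff_X_mul_derivative]
    rcases k with _ | _ | k
    · simp
    · rw [zero_add, coeff_one_X_sq_mul, coeff_one_X_sq_mul, coeff_mk, h1]
      simp
    · rw [coeff_X_sq_mul, coeff_X_sq_mul, coeff_X_mul_derivative, coeff_mk, coeff_mk]
      have := hrec k
      push_cast
      linarith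
  have hp : X * derivative ℝ (mk a ^ p) - X ^ 2 * (X * derivative ℝ (mk a ^ p)) =
      C (p : ℝ) * (X ^ 2 * mk a ^ p) := by
    rcases p with _ | p
    · simp
    · rw [derivative_pow, Nat.add_sub_cancel, pow_succ, map_natCast]
      linear_combination ((p + 1 : ℕ) : ℝ⟦X⟧) * mk a ^ p * hM
  have hF0 : coeff 0 (mk a ^ p) = 1 := by simp [h0]
  generalize mk a ^ p = F at *
  refine ⟨hF0, ?_, fun k => ?_⟩
  · have := congrArg (coeff 1) hp
    rw [map_sub, coeff_X_mul_derivative, coeff_C_mul, coeff_one_X_sq_mul,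
      coeff_one_X_sq_mul] at this
    simpa using this
  · have := congrArg (coeff (k + 2)) hp
    rw [map_sub, coeff_X_mul_derivative, coeff_C_mul, coeff_X_sq_mul, coeff_X_sq_mul,
      coeff_X_mul_derivative] at this
    push_cast at this
    linarith

/-- With `M = mk a`, the recursion reads `z (1 - z²) M' = 2 - 2 M + z² M`. Then `Q = z² M² - 4 (M -
1)` satisfies `z (1 - z²) Q' = -2 Q`, that is `(k + 2) q_k = (k - 2) q_{k-2}`, which forces `Q = 0`.
-/
lemma X_sq_mul_sq_of_semicircle_recursion (a : ℕ → ℝ) (h0 : a 0 = 1) (h1 : a 1 = 0)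
    (hrec : ∀ k : ℕ, ((k : ℝ) + 4) * a (k + 2) = (k + 1) * a k) :
    X ^ 2 * mk a ^ 2 = C 4 * (mk a - 1) := by
  have hM : X * derivative ℝ (mk a) - X ^ 2 * (X * derivative ℝ (mk a)) =
      C 2 - C 2 * mk a + X ^ 2 * mk a := by
    ext k
    rw [map_sub, map_add, map_sub, coeff_X_mul_derivative, coeff_C_mul]
    rcases k with _ | _ | k
    · simp [h0]
    · rw [zero_add, coeff_one_X_sq_mul, coeff_one_X_sq_mul, coeff_mk, h1, coeff_C]
      simp
    · rw [coeff_X_sq_mul, coeff_X_sq_mul, coeff_X_mul_derivative, coeff_mk, coeff_mk, coeff_C]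
      have := hrec k
      simp
      linarith
  have hC2 : (C (2 : ℝ)) = 2 := map_ofNat _ _
  have hC4 : (C (4 : ℝ)) = 4 := map_ofNat _ _
  have hD : derivative ℝ (X ^ 2 * mk a ^ 2 - C 4 * (mk a - 1)) =
      C 2 * X * mk a ^ 2 + C 2 * X ^ 2 * mk a * derivative ℝ (mk a) - C 4 * derivative ℝ (mk a) := by
    simp only [map_sub, Derivation.leibniz, derivative_pow, derivative_C, smul_eq_mul, derivative_X,
      Derivation.map_one_eq_zero]
    rw [hC2]
    simp
    ring
  have hQ : X * derivative ℝ (X ^ 2 * mk a ^ 2 - C 4 * (mk a - 1)) -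
      X ^ 2 * (X * derivative ℝ (X ^ 2 * mk a ^ 2 - C 4 * (mk a - 1))) =
      - (C 2 * (X ^ 2 * mk a ^ 2 - C 4 * (mk a - 1))) := by
    rw [hD]
    rw [hC2] at hM ⊢
    rw [hC4]
    -- The multiplier is the derivative of `Q` with respect to `M`.
    linear_combination (2 * X ^ 2 * mk a - 4) * hM
  rw [← sub_eq_zero]
  generalize X ^ 2 * mk a ^ 2 - C 4 * (mk a - 1) = Q at *
  ext k
  rw [map_zero]
  induction k using Nat.strong_induction_on with
  | _ k ih =>
    have h := congrArg (coeff k) hQ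
    rw [map_sub, map_neg, coeff_X_mul_derivative, coeff_C_mul] at h
    rcases k with _ | _ | k
    · rw [coeff_zero_X_sq_mul] at h
      simp at h ⊢
      exact h
    · rw [zero_add, coeff_one_X_sq_mul] at h
      push_cast at h
      rw [zero_add]
      linarith
    · rw [coeff_X_sq_mul, coeff_X_mul_derivative, ih k (by omega)] at h
      push_cast at h
      have h4 : ((k : ℝ) + 4) ≠ 0 := by positivity
      refine (mul_eq_zero.1 ?_).resolve_left h4
      linarith

/-- A two-term recursion in the order of a convolution power, solved in closed form. -/
lemma convolution_power_recursion (b : ℕ → ℕ → ℝ) (h0 : ∀ p, b p 0 = 1)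
    (hb0 : ∀ k, b 0 (k + 1) = 0) (hb1 : b 1 1 = 0)
    (hrec : ∀ k : ℕ, ((k : ℝ) + 4) * b 1 (k + 2) = (k + 1) * b 1 k)
    (hstep : ∀ p k, b (p + 2) k = 4 * (b (p + 1) (k + 2) - b p (k + 2))) (p : ℕ) :
    (b p 1 = 0 ∧ ∀ k : ℕ, ((k : ℝ) + 2) * (k + 2 * p + 2) * b p (k + 2) =
        (p + k + 1) * (p + k) * b p k) ∧
    (b (p + 1) 1 = 0 ∧ ∀ k : ℕ, ((k : ℝ) + 2) * (k + 2 * (p + 1 : ℕ) + 2) * b (p + 1) (k + 2) =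
        ((p + 1 : ℕ) + k + 1) * ((p + 1 : ℕ) + k) * b (p + 1) k) := by
  induction p with
  | zero =>
    refine ⟨⟨hb0 0, fun k => ?_⟩, hb1, fun k => ?_⟩
    · rw [hb0 (k + 1)]
      rcases k with _ | k
      · simp
      · rw [hb0 k]; simp
    · have := hrec k
      push_cast
      linear_combination ((k : ℝ) + 2) * this
  | succ p ih =>
    obtain ⟨⟨hp1, hp⟩, hq1, hq⟩ := ih
    refine ⟨⟨hq1, hq⟩, ?_⟩
    -- The ratio argument below divides by `p`. For `p = 0`, row `0` vanishes beyond its first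
    -- entry, so row `2` is a shift of row `1`.
    rcases Nat.eq_zero_or_pos p with rfl | hpos
    · have hb2 (k : ℕ) : b 2 k = 4 * b 1 (k + 2) := by
        rw [hstep 0 k, hb0 (k + 1), sub_zero]
      refine ⟨?_, fun k => ?_⟩
      · have := hq 1
        rw [hb1] at this
        simp at this
        rcases this with this | this
        · norm_num at this
        · rw [hb2, this]; simp
      · have := hq (k + 2)
        rw [hb2, hb2]
        push_cast at this ⊢
        have h4 : ((k : ℝ) + 4) ≠ 0 := by positivity
        refine mul_left_cancel₀ h4 ?_
        linear_combination 4 * (k + 2) * this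
    · have hp0 : (p : ℝ) ≠ 0 := by positivity
      push_cast at hq
      -- Neighbouring rows are proportional entry by entry, with an explicit ratio: both satisfy
      -- two-step recursions in `k`, and the ratio is checked at `k = 0` and `k = 1`. Through
      -- `hstep`, row `p + 2` then becomes a multiple of a shift of row `p`.
      have hratio : ∀ k : ℕ, (p : ℝ) * (k + 2 * p + 2) * b (p + 1) k = 2 * (p + 1) * (k + p) * b p k ∧
          (p : ℝ) * ((k + 1 : ℕ) + 2 * p + 2) * b (p + 1) (k + 1) =
            2 * (p + 1) * ((k + 1 : ℕ) + p) * b p (k + 1) := by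
        intro k
        induction k with
        | zero =>
          refine ⟨?_, ?_⟩
          · rw [h0, h0]; push_cast; ring
          · rw [zero_add, hp1, hq1]; simp
        | succ k ih =>
          refine ⟨ih.2, ?_⟩
          have h1 := hp k
          have h2 := hq k
          have h3 := ih.1
          have h4 : ((k : ℝ) + 2) * (k + 2 * p + 2) ≠ 0 := by positivity
          refine mul_left_cancel₀ h4 ?_
          push_cast
          rw [show k + 1 + 1 = k + 2 by ring]
          linear_combination (p * (k + 2 * p + 2) : ℝ) * h2 +
            ((p + k + 1) * (p + k + 2) : ℝ) * h3 - (2 * (p + 1) * (k + p + 2) : ℝ) * h1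
      have hnew (k : ℕ) : (p : ℝ) * (k + 2 * p + 4) * b (p + 2) k =
          4 * (p + 2) * (k + 2) * b p (k + 2) := by
        have := (hratio (k + 2)).1
        rw [hstep]
        push_cast at this
        linear_combination 4 * this
      have hden (k : ℕ) : (p : ℝ) * (k + 2 * p + 4) ≠ 0 := by positivity
      refine ⟨?_, fun k => ?_⟩
      · have h1 := hp 1
        rw [hp1, mul_zero] at h1
        have h2 : b p (1 + 2) = 0 := by
          refine (mul_eq_zero.1 h1).resolve_left ?_
          positivity
        have := hnew 1
        rw [h2, mul_zero] at this
        exact (mul_eq_zero.1 this).resolve_left (hden 1)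
      · have h1 := hp (k + 2)
        have h2 := hnew (k + 2)
        have h3 := hnew k
        refine mul_left_cancel₀ (hden k) ?_
        push_cast at *
        rw [show p + 1 + 1 = p + 2 by ring]
        linear_combination ((k + 2) * (k + 2 * p + 4) : ℝ) * h2 -
          ((p + k + 3) * (p + k + 2) : ℝ) * h3 + (4 * (p + 2) * (k + 2) : ℝ) * h1

/-- Multiplying the quadratic equation by `M^p` gives `z² M^(p+2) = 4 (M^(p+1) - M^p)`, the relation
between successive powers on which `convolution_power_recursion` runs. -/
lemma coeff_pow_of_semicircle_recursion (a : ℕ → ℝ) (h0 : a 0 = 1) (h1 : a 1 = 0)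
    (hrec : ∀ k : ℕ, ((k : ℝ) + 4) * a (k + 2) = (k + 1) * a k) (p : ℕ) :
    coeff 1 (mk a ^ p) = 0 ∧
      ∀ k : ℕ, ((k : ℝ) + 2) * (k + 2 * p + 2) * coeff (k + 2) (mk a ^ p) =
        (p + k + 1) * (p + k) * coeff k (mk a ^ p) := by
  have hquad := X_sq_mul_sq_of_semicircle_recursion a h0 h1 hrec
  refine (convolution_power_recursion (fun p k => coeff k (mk a ^ p)) (fun p => by simp [h0])
    (fun k => by simp [coeff_one]) (by simp [h1]) (fun k => by simpa using hrec k)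
    (fun p k => ?_) p).1
  have h : X ^ 2 * mk a ^ (p + 2) = C 4 * (mk a ^ (p + 1) - mk a ^ p) := by
    linear_combination mk a ^ p * hquad
  rw [← coeff_X_sq_mul, h, coeff_C_mul, map_sub]

end PowerSeriesRecursions

/-! ### Moments of the motion at time one -/

lemma integral_pow_mul_one_sub_pow (i j : ℕ) :
    ∫ w in (0 : ℝ)..1, w ^ i * (1 - w) ^ j = i.factorial * j.factorial / (i + j + 1).factorial := by
  induction j generalizing i with
  | zero =>
    simp [integral_pow, Nat.factorial_succ]
    have : (i.factorial : ℝ) ≠ 0 := by positivity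
    field_simp
  | succ j ih =>
    have hd (w : ℝ) : HasDerivAt (fun w : ℝ => w ^ (i + 1) * (1 - w) ^ (j + 1))
        ((i + 1) * (w ^ i * (1 - w) ^ (j + 1)) - (j + 1) * (w ^ (i + 1) * (1 - w) ^ j)) w := by
      have h1 := (hasDerivAt_pow (i + 1) w)
      have h2 := ((hasDerivAt_id w).const_sub 1).pow (j + 1)
      refine (h1.mul h2).congr_deriv ?_
      simp only [Pi.pow_apply, id, Nat.add_sub_cancel]
      push_cast
      ring
    have h := intervalIntegral.integral_eq_sub_of_hasDerivAt (a := 0) (b := 1)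
      (fun w _ => hd w) (Continuous.intervalIntegrable (by fun_prop) _ _)
    rw [intervalIntegral.integral_sub (Continuous.intervalIntegrable (by fun_prop) _ _)
      (Continuous.intervalIntegrable (by fun_prop) _ _), intervalIntegral.integral_const_mul,
      intervalIntegral.integral_const_mul, ih (i + 1)] at h
    simp at h
    have h3 : (i : ℝ) + 1 ≠ 0 := by positivity
    rw [show i + (j + 1) + 1 = i + 1 + j + 1 by ring]
    have : ((i + 1 + j + 1).factorial : ℝ) ≠ 0 := by positivity
    rw [eq_div_iff this]
    apply mul_left_cancel₀ h3
    rw [Nat.factorial_succ i, Nat.factorial_succ j] at *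
    field_simp at h
    push_cast at h ⊢
    linarith

/-- The moments of the cosine of an angle distributed according to `angleMeasure m`. -/
lemma angleMeasure_cos_moments (m : Fin 2) [IsProbabilityMeasure (angleMeasure ((m : ℕ) : ℝ))] :
    (∫ a, Real.cos a ^ 0 ∂angleMeasure ((m : ℕ) : ℝ) = 1) ∧
    (∫ a, Real.cos a ^ 1 ∂angleMeasure ((m : ℕ) : ℝ) = 0) ∧
    ∀ k : ℕ, ((k : ℝ) + 2 * (m : ℕ) + 2) * ∫ a, Real.cos a ^ (k + 2) ∂angleMeasure ((m : ℕ) : ℝ) =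
      (k + 1) * ∫ a, Real.cos a ^ k ∂angleMeasure ((m : ℕ) : ℝ) := by
  have hI (k : ℕ) : ((k : ℝ) + 2) * ∫ a in (0 : ℝ)..Real.pi, Real.cos a ^ (k + 2) =
      (k + 1) * ∫ a in (0 : ℝ)..Real.pi, Real.cos a ^ k := by
    rw [integral_cos_pow]
    simp
    field_simp
  have hI1 : ∫ a in (0 : ℝ)..Real.pi, Real.cos a ^ 1 = 0 := by simp
  have hJ (k : ℕ) : ∫ a in (0 : ℝ)..Real.pi, Real.sin a ^ 2 * Real.cos a ^ k =
      (∫ a in (0 : ℝ)..Real.pi, Real.cos a ^ k) - ∫ a in (0 : ℝ)..Real.pi, Real.cos a ^ (k + 2) := by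
    rw [← intervalIntegral.integral_sub (Continuous.intervalIntegrable (by fun_prop) _ _)
      (Continuous.intervalIntegrable (by fun_prop) _ _)]
    refine intervalIntegral.integral_congr fun a _ => ?_
    simp only [Real.sin_sq]
    ring
  -- The recursion is homogeneous, so the value of the normalizing constant plays no role; the
  -- zeroth moment comes from the total mass.
  obtain ⟨C, hC⟩ : ∃ C : ℝ, ∀ k : ℕ, ∫ a, Real.cos a ^ k ∂angleMeasure ((m : ℕ) : ℝ) =
      C * ∫ a in (0 : ℝ)..Real.pi, Real.sin a ^ (2 * (m : ℕ)) * Real.cos a ^ k := by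
    refine ⟨Real.Gamma ((m : ℕ) + 1) / (√Real.pi * Real.Gamma ((m : ℕ) + 1 / 2)), fun k => ?_⟩
    rw [angleMeasure, integral_withDensity_eq_integral_toReal_smul (by fun_prop) (by simp),
      intervalIntegral.integral_of_le Real.pi_pos.le, integral_Ioc_eq_integral_Ioo,
      ← integral_const_mul]
    refine setIntegral_congr_fun measurableSet_Ioo fun a ha => ?_
    have hs := Real.sin_pos_of_mem_Ioo ha
    have h1 : 0 < Real.Gamma ((m : ℕ) + 1) := Real.Gamma_pos_of_pos (by positivity)
    have h2 : 0 < Real.Gamma ((m : ℕ) + 1 / 2) := Real.Gamma_pos_of_pos (by positivity)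
    rw [ENNReal.toReal_ofReal (by positivity), smul_eq_mul, mul_assoc]
    congr 2
    rw [← Real.rpow_natCast]
    push_cast
    rfl
  refine ⟨by simp, ?_, fun k => ?_⟩
  · rw [hC]
    obtain rfl | rfl : m = 0 ∨ m = 1 := by omega
    · simp
    · have h3 := hI 1
      have := hJ 1
      rw [hI1, mul_zero] at h3
      have h4 : ∫ a in (0 : ℝ)..Real.pi, Real.cos a ^ (1 + 2) = 0 :=
        (mul_eq_zero.1 h3).resolve_left (by norm_num)
      rw [show 2 * ((1 : Fin 2) : ℕ) = 2 from rfl, this, h4, hI1]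
      simp
  · rw [hC, hC]
    obtain rfl | rfl : m = 0 ∨ m = 1 := by omega
    · simp
      have := hI k
      linear_combination C * this
    · rw [show 2 * ((1 : Fin 2) : ℕ) = 2 from rfl, hJ, hJ]
      have h1 := hI k
      have h2 := hI (k + 2)
      rw [Fin.val_one, Nat.cast_one]
      push_cast at h2
      linear_combination C * h1 - C * h2

/-- Each step takes a convex combination of two points of `[-c, c]`. Boundedness makes all moments
finite. -/
lemma ae_abs_le_unitLaw {c : ℝ} (hc : 0 < c) (α : Measure ℝ) [IsProbabilityMeasure α] (n : ℕ) :
    ∀ᵐ y ∂unitLaw c α n, |y| ≤ c := by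
  have hms : MeasurableSet {y : ℝ | |y| ≤ c} := measurableSet_le (by fun_prop) (by fun_prop)
  induction n with
  | zero =>
    rw [unitLaw, ae_map_iff (by fun_prop) hms]
    refine Filter.Eventually.of_forall fun a => ?_
    rw [abs_mul, abs_of_pos hc]
    exact mul_le_of_le_one_right hc.le (Real.abs_cos_le_one a)
  | succ n ih =>
    rw [unitLaw, ae_map_iff (by fun_prop) hms]
    have hw : ∀ᵐ w ∂headLaw n, w ∈ Set.Ioo (0 : ℝ) 1 :=
      (withDensity_absolutelyContinuous _ _).ae_le (ae_restrict_mem measurableSet_Ioo)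
    have hw' := (Measure.quasiMeasurePreserving_fst (μ := headLaw n)
      (ν := α.prod (unitLaw c α n))).ae hw
    have hy := (Measure.quasiMeasurePreserving_snd (μ := headLaw n)
      (ν := α.prod (unitLaw c α n))).ae
        ((Measure.quasiMeasurePreserving_snd (μ := α) (ν := unitLaw c α n)).ae ih)
    filter_upwards [hw', hy] with p hp hy
    have h1 : |c * p.1 * Real.cos p.2.1| ≤ c * p.1 := by
      have : 0 ≤ c * p.1 := mul_nonneg hc.le hp.1.le
      rw [abs_mul, abs_of_nonneg this]
      exact mul_le_of_le_one_right this (Real.abs_cos_le_one _)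
    have h2 : |(1 - p.1) * p.2.2| ≤ (1 - p.1) * c := by
      have : 0 ≤ 1 - p.1 := by linarith [hp.2]
      rw [abs_mul, abs_of_nonneg this]
      exact mul_le_mul_of_nonneg_left hy this
    calc _ ≤ _ := abs_add_le _ _
      _ ≤ c * p.1 + (1 - p.1) * c := add_le_add h1 h2
      _ = c := by ring

lemma integrable_pow_unitLaw {c : ℝ} (hc : 0 < c) (α : Measure ℝ) [IsProbabilityMeasure α]
    (n k : ℕ) : Integrable (fun y => y ^ k) (unitLaw c α n) := by
  refine Integrable.of_bound (by fun_prop) (c ^ k) ?_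
  filter_upwards [ae_abs_le_unitLaw hc α n] with y hy
  rw [norm_pow, Real.norm_eq_abs]
  gcongr

lemma integral_headLaw_pow (n i j : ℕ) :
    ∫ w, w ^ i * (1 - w) ^ j ∂headLaw n =
      (n + 1) * (i.factorial * (n + j).factorial / (n + i + j + 1).factorial) := by
  rw [headLaw, integral_withDensity_eq_integral_toReal_smul (by fun_prop) (by simp),
    show n + i + j + 1 = i + (n + j) + 1 by ring, ← integral_pow_mul_one_sub_pow,
    intervalIntegral.integral_of_le zero_le_one, integral_Ioc_eq_integral_Ioo,
    ← integral_const_mul]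
  refine setIntegral_congr_fun measurableSet_Ioo fun w hw => ?_
  have : 0 ≤ 1 - w := by linarith [hw.2]
  rw [ENNReal.toReal_ofReal (by positivity), smul_eq_mul]
  ring

lemma integrable_headLaw_pow (n i j : ℕ) :
    Integrable (fun w => w ^ i * (1 - w) ^ j) (headLaw n) := by
  have hw : ∀ᵐ w ∂headLaw n, w ∈ Set.Ioo (0 : ℝ) 1 :=
    (withDensity_absolutelyContinuous _ _).ae_le (ae_restrict_mem measurableSet_Ioo)
  refine Integrable.of_bound (by fun_prop) 1 ?_
  filter_upwards [hw] with w hw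
  have : 0 ≤ 1 - w := by linarith [hw.2]
  have : 0 ≤ w := hw.1.le
  rw [Real.norm_of_nonneg (by positivity)]
  exact mul_le_one₀ (pow_le_one₀ hw.1.le hw.2.le) (by positivity)
    (pow_le_one₀ (by linarith [hw.2]) (by linarith [hw.1]))

/-- The moments of `unitLaw c α n` are the coefficients of the `(n + 1)`-st power of the generating
function of the moments of the cosine of one angle, up to factorials. -/
lemma integral_pow_unitLaw {c : ℝ} (hc : 0 < c) (α : Measure ℝ) [IsProbabilityMeasure α]
    (n k : ℕ) :
    ∫ y, y ^ k ∂unitLaw c α n = c ^ k * (n.factorial * k.factorial / (n + k).factorial) *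
      PowerSeries.coeff k ((PowerSeries.mk fun k => ∫ a, Real.cos a ^ k ∂α) ^ (n + 1)) := by
  induction n generalizing k with
  | zero =>
    rw [unitLaw, integral_map (by fun_prop) (by fun_prop)]
    have : (k.factorial : ℝ) ≠ 0 := by positivity
    simp [mul_pow, integral_const_mul, this]
  | succ n ih =>
    rw [unitLaw, integral_map (by fun_prop) (by fun_prop)]
    -- After the binomial expansion, the factorials of the beta integral cancel the binomial
    -- coefficient and the denominator `(n + q.2)!` of the induction hypothesis. What remains is the
    -- Cauchy product for one more factor of the series.
    have hexp (p : ℝ × ℝ × ℝ) : (c * p.1 * Real.cos p.2.1 + (1 - p.1) * p.2.2) ^ k =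
        ∑ q ∈ Finset.HasAntidiagonal.antidiagonal k, ((k.choose q.1 : ℝ) * c ^ q.1) *
          ((p.1 ^ q.1 * (1 - p.1) ^ q.2) * (Real.cos p.2.1 ^ q.1 * p.2.2 ^ q.2)) := by
      rw [(Commute.all _ _).add_pow']
      refine Finset.sum_congr rfl fun q _ => ?_
      rw [nsmul_eq_mul, mul_pow, mul_pow, mul_pow]
      ring
    have hcos (i : ℕ) : Integrable (fun a => Real.cos a ^ i) α := by
      refine Integrable.of_bound (by fun_prop) 1 (Filter.Eventually.of_forall fun a => ?_)
      rw [norm_pow, Real.norm_eq_abs]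
      exact pow_le_one₀ (abs_nonneg _) (Real.abs_cos_le_one a)
    simp_rw [hexp]
    rw [integral_finsetSum]
    · rw [pow_succ' _ (n + 1), PowerSeries.coeff_mul, Finset.mul_sum]
      refine Finset.sum_congr rfl fun q hq => ?_
      rw [Finset.HasAntidiagonal.mem_antidiagonal] at hq
      rw [integral_const_mul, integral_prod_mul (fun w : ℝ => w ^ q.1 * (1 - w) ^ q.2)
        (fun p : ℝ × ℝ => Real.cos p.1 ^ q.1 * p.2 ^ q.2),
        integral_prod_mul (fun a : ℝ => Real.cos a ^ q.1) (fun y : ℝ => y ^ q.2), ih,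
        integral_headLaw_pow, PowerSeries.coeff_mk]
      have hch : (k.choose q.1 : ℝ) * q.1.factorial * q.2.factorial = k.factorial := by
        have := Nat.choose_mul_factorial_mul_factorial (n := k) (k := q.1) (by omega)
        rw [show k - q.1 = q.2 by omega] at this
        exact_mod_cast this
      rw [show n + q.1 + q.2 + 1 = n + 1 + k by omega, ← hch, ← hq, pow_add c q.1 q.2,
        Nat.factorial_succ n]
      have : ((n + q.2).factorial : ℝ) ≠ 0 := by positivity
      push_cast
      field_simp
    · intro q _
      exact (((integrable_headLaw_pow n q.1 q.2).mul_prod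
        ((hcos q.1).mul_prod (integrable_pow_unitLaw hc α n q.2)))).const_mul _

/-- The moments of `unitLaw`, when the angles are distributed according to `angleMeasure m`. -/
theorem unitLaw_moments {c : ℝ} (hc : 0 < c) (m : Fin 2)
    [IsProbabilityMeasure (angleMeasure ((m : ℕ) : ℝ))] (n : ℕ) :
    (∫ y, y ^ 1 ∂unitLaw c (angleMeasure ((m : ℕ) : ℝ)) n = 0) ∧
    ∀ k : ℕ, ((k : ℝ) + 2 * vParam m n + 2) *
        ∫ y, y ^ (k + 2) ∂unitLaw c (angleMeasure ((m : ℕ) : ℝ)) n =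
      c ^ 2 * (k + 1) * ∫ y, y ^ k ∂unitLaw c (angleMeasure ((m : ℕ) : ℝ)) n := by
  obtain ⟨h0, h1, hrec⟩ := angleMeasure_cos_moments m
  have hfac (k : ℕ) : ((n + (k + 2)).factorial : ℝ) = (n + k + 2) * (n + k + 1) * (n + k).factorial := by
    rw [show n + (k + 2) = n + k + 1 + 1 by ring, Nat.factorial_succ, Nat.factorial_succ]
    push_cast; ring
  have hfac' (k : ℕ) : ((k + 2).factorial : ℝ) = (k + 2) * (k + 1) * k.factorial := by
    rw [Nat.factorial_succ, Nat.factorial_succ]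
    push_cast; ring
  obtain rfl | rfl : m = 0 ∨ m = 1 := by omega
  -- There is one factor per segment, hence the exponent `n + 1`. The factorials cancel `k + n + 1`
  -- and leave `k + n + 2`, which is `k + 2 v_0 + 2`.
  · obtain ⟨-, g1, g⟩ := coeff_pow_of_arcsine_recursion
      (fun k => ∫ a, Real.cos a ^ k ∂angleMeasure (((0 : Fin 2) : ℕ) : ℝ)) h0 h1
      (fun k => by simpa using hrec k) (n + 1)
    refine ⟨by rw [integral_pow_unitLaw hc, g1, mul_zero], fun k => ?_⟩
    have hk := g k
    rw [integral_pow_unitLaw hc, integral_pow_unitLaw hc, hfac, hfac', vParam, if_pos rfl]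
    generalize PowerSeries.coeff (R := ℝ) (k + 2) _ = y at *
    generalize PowerSeries.coeff (R := ℝ) k _ = z at *
    have h1 : ((n + k).factorial : ℝ) ≠ 0 := by positivity
    push_cast at hk
    field_simp
    linear_combination (c ^ 2 * c ^ k * (n + k + 2) : ℝ) * hk
  · obtain ⟨g1, g⟩ := coeff_pow_of_semicircle_recursion
      (fun k => ∫ a, Real.cos a ^ k ∂angleMeasure (((1 : Fin 2) : ℕ) : ℝ)) h0 h1
      (fun k => by have := hrec k; norm_num at this; norm_num; linarith) (n + 1)
    refine ⟨by rw [integral_pow_unitLaw hc, g1, mul_zero], fun k => ?_⟩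
    have hk := g k
    rw [integral_pow_unitLaw hc, integral_pow_unitLaw hc, hfac, hfac', vParam, if_neg (by decide)]
    generalize PowerSeries.coeff (R := ℝ) (k + 2) _ = y at *
    generalize PowerSeries.coeff (R := ℝ) k _ = z at *
    have h1 : ((n + k).factorial : ℝ) ≠ 0 := by positivity
    push_cast at hk
    field_simp
    linear_combination (c ^ 2 * c ^ k : ℝ) * hk

/-! ### Determinacy by moments, and Gaussian moments -/

/-- A finite measure on the line with finite exponential moments of all orders is determined by its
moments. -/
theorem ext_of_integral_pow_eq {μ ν : Measure ℝ} [IsFiniteMeasure μ] [IsFiniteMeasure ν]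
    (hμ : ∀ a : ℝ, Integrable (fun x => Real.exp (a * x)) μ)
    (hν : ∀ a : ℝ, Integrable (fun x => Real.exp (a * x)) ν)
    (h : ∀ k : ℕ, ∫ x, x ^ k ∂μ = ∫ x, x ^ k ∂ν) : μ = ν := by
  have huniv {ρ : Measure ℝ} (hρ : ∀ a : ℝ, Integrable (fun x => Real.exp (a * x)) ρ) :
      interior (integrableExpSet id ρ) = Set.univ := by
    rw [show integrableExpSet id ρ = Set.univ from Set.eq_univ_of_forall hρ, interior_univ]
  have hdiff {ρ : Measure ℝ} (hρ : ∀ a : ℝ, Integrable (fun x => Real.exp (a * x)) ρ) :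
      Differentiable ℂ (complexMGF id ρ) := by
    intro z
    have := differentiableOn_complexMGF (X := id) (μ := ρ)
    rw [huniv hρ] at this
    simp only [Set.mem_univ, Set.ofPred_true] at this
    exact this.differentiableAt Filter.univ_mem
  have hder {ρ : Measure ℝ} (hρ : ∀ a : ℝ, Integrable (fun x => Real.exp (a * x)) ρ) (k : ℕ) :
      iteratedDeriv k (complexMGF id ρ) 0 = ((∫ x, x ^ k ∂ρ : ℝ) : ℂ) := by
    rw [iteratedDeriv_complexMGF (by rw [huniv hρ]; trivial), ← integral_complex_ofReal]
    simp
  -- The complex moment generating function is entire, its Taylor coefficients at `0` are given by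
  -- the moments, and it determines the measure.
  refine Measure.ext_of_complexMGF_id_eq (funext fun z => ?_)
  rw [← Complex.taylorSeries_eq_of_entire' 0 z (hdiff hμ),
    ← Complex.taylorSeries_eq_of_entire' 0 z (hdiff hν)]
  simp_rw [hder hμ, hder hν, h]

/-- Differentiating `exp (t ^ 2 / 2)` repeatedly, `φ_n(t) = E (Z^n exp (t Z))` satisfies `φ_{n+2} =
t φ_{n+1} + (n + 1) φ_n`. The variable `t` is kept free for the induction and set to `0` at the end.
-/
lemma gaussian_moments :
    (∫ x, x ^ 1 ∂gaussianReal 0 1 = 0) ∧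
    ∀ k : ℕ, ∫ x, x ^ (k + 2) ∂gaussianReal 0 1 = (k + 1) * ∫ x, x ^ k ∂gaussianReal 0 1 := by
  have hd (n : ℕ) (t : ℝ) := hasDerivAt_integral_pow_mul_exp_real (X := id) (μ := gaussianReal 0 1)
    (t := t) (by rw [integrableExpSet_id_gaussianReal]; simp) n
  simp only [id] at hd
  have h0 (t : ℝ) : ∫ x, x ^ 0 * Real.exp (t * x) ∂gaussianReal 0 1 = Real.exp (t ^ 2 / 2) := by
    have := congrFun (mgf_id_gaussianReal (μ := 0) (v := 1)) t
    simpa [mgf] using this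
  have h1 (t : ℝ) : ∫ x, x ^ 1 * Real.exp (t * x) ∂gaussianReal 0 1 =
      t * ∫ x, x ^ 0 * Real.exp (t * x) ∂gaussianReal 0 1 := by
    have e1 := hd 0 t
    simp_rw [h0] at e1 ⊢
    have e2 : HasDerivAt (fun t : ℝ => Real.exp (t ^ 2 / 2)) (Real.exp (t ^ 2 / 2) * t) t := by
      refine (((hasDerivAt_pow 2 t).div_const 2).exp).congr_deriv ?_
      simp
    rw [e1.unique e2, mul_comm]
  have hrec (n : ℕ) : ∀ t : ℝ, ∫ x, x ^ (n + 2) * Real.exp (t * x) ∂gaussianReal 0 1 =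
      t * (∫ x, x ^ (n + 1) * Real.exp (t * x) ∂gaussianReal 0 1) +
        (n + 1) * ∫ x, x ^ n * Real.exp (t * x) ∂gaussianReal 0 1 := by
    induction n with
    | zero =>
      intro t
      have e1 := hd 1 t
      have e2 := (hasDerivAt_id t).mul (hd 0 t)
      have e3 := e1.congr_of_eventuallyEq (Filter.Eventually.of_forall fun t => (h1 t).symm)
      rw [e3.unique e2]
      simp
      ring
    | succ n ih =>
      intro t
      have e1 := hd (n + 2) t
      have e2 := ((hasDerivAt_id t).mul (hd (n + 1) t)).add ((hd n t).const_mul ((n : ℝ) + 1))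
      have e3 := e1.congr_of_eventuallyEq (Filter.Eventually.of_forall fun t => (ih t).symm)
      rw [show n + 1 + 2 = n + 2 + 1 by ring, e3.unique e2]
      simp only [id]
      push_cast
      ring
  refine ⟨by simp, fun k => by simpa using hrec k 0⟩

/-! ### Bessel and beta laws -/

/-- The density of a Bessel process at time `t`, without its normalizing factor. -/
def besselWeight (d : ℕ) (t s : ℝ) : ℝ :=
  s ^ ((d : ℝ) - 1) * Real.exp (-s ^ 2 / (2 * t)) / t ^ ((d : ℝ) / 2)

/-- The law of a `d`-dimensional Bessel process at time `t > 0`. -/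
def besselLaw (d : ℕ) (t : ℝ) : Measure ℝ :=
  ENNReal.ofReal (1 / (Real.Gamma ((d : ℝ) / 2) * 2 ^ ((d : ℝ) / 2 - 1))) •
    (volume.restrict (Set.Ioi 0)).withDensity fun s => ENNReal.ofReal (besselWeight d t s)

@[fun_prop]
lemma measurable_besselWeight_uncurry (d : ℕ) :
    Measurable fun p : ℝ × ℝ => besselWeight d p.1 p.2 := by
  unfold besselWeight
  fun_prop

lemma measurable_besselWeight (d : ℕ) (t : ℝ) : Measurable (besselWeight d t) :=
  (measurable_besselWeight_uncurry d).comp measurable_prodMk_left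

lemma besselWeight_nonneg (d : ℕ) {t s : ℝ} (ht : 0 ≤ t) (hs : 0 ≤ s) : 0 ≤ besselWeight d t s := by
  unfold besselWeight
  positivity

lemma lintegral_besselLaw (d : ℕ) (t : ℝ) {f : ℝ → ℝ≥0∞} (hf : Measurable f) :
    ∫⁻ s, f s ∂besselLaw d t =
      ENNReal.ofReal (1 / (Real.Gamma ((d : ℝ) / 2) * 2 ^ ((d : ℝ) / 2 - 1))) *
        ∫⁻ s in Set.Ioi (0 : ℝ), ENNReal.ofReal (besselWeight d t s) * f s := by
  rw [besselLaw, lintegral_smul_measure, lintegral_withDensity_eq_lintegral_mul _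
    (measurable_besselWeight d t).ennreal_ofReal hf]
  rfl

lemma integral_besselLaw_pow {d : ℕ} (hd : 1 ≤ d) {t : ℝ} (ht : 0 < t) (k : ℕ) :
    ∫ s, s ^ k ∂besselLaw d t = 1 / (Real.Gamma ((d : ℝ) / 2) * 2 ^ ((d : ℝ) / 2 - 1)) *
      ((1 / t ^ ((d : ℝ) / 2)) * ((1 / (2 * t)) ^ (-((d : ℝ) - 1 + k + 1) / 2) * (1 / 2) *
        Real.Gamma (((d : ℝ) - 1 + k + 1) / 2))) := by
  have hd' : (1 : ℝ) ≤ d := by exact_mod_cast hd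
  have hG : 0 < Real.Gamma ((d : ℝ) / 2) := Real.Gamma_pos_of_pos (by positivity)
  rw [besselLaw, integral_smul_measure, ENNReal.toReal_ofReal (by positivity), smul_eq_mul,
    integral_withDensity_eq_integral_toReal_smul (measurable_besselWeight d t).ennreal_ofReal
      (by simp)]
  congr 1
  rw [← integral_rpow_mul_exp_neg_mul_rpow (p := 2) (q := (d : ℝ) - 1 + k) (b := 1 / (2 * t))
    (by norm_num) (by have : (0 : ℝ) ≤ k := by positivity
                      linarith) (by positivity), ← integral_const_mul]
  refine setIntegral_congr_fun measurableSet_Ioi fun s (hs : 0 < s) => ?_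
  rw [ENNReal.toReal_ofReal (besselWeight_nonneg d ht.le hs.le), besselWeight, smul_eq_mul,
    Real.rpow_add hs, Real.rpow_natCast, Real.rpow_two]
  rw [show -(1 / (2 * t)) * s ^ 2 = -s ^ 2 / (2 * t) by ring]
  ring

lemma isProbabilityMeasure_besselLaw {d : ℕ} (hd : 1 ≤ d) {t : ℝ} (ht : 0 < t) :
    IsProbabilityMeasure (besselLaw d t) := by
  have hd' : (1 : ℝ) ≤ d := by exact_mod_cast hd
  have hG : 0 < Real.Gamma ((d : ℝ) / 2) := Real.Gamma_pos_of_pos (by positivity)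
  have h := integral_besselLaw_pow hd ht 0
  have h1 : (besselLaw d t).real Set.univ = 1 := by
    simp only [pow_zero, integral_const, smul_eq_mul, mul_one] at h
    rw [h]
    have : ((d : ℝ) - 1 + (0 : ℕ) + 1) = d := by push_cast; ring
    rw [neg_div, this, one_div (2 * t), Real.inv_rpow (by positivity),
      Real.rpow_neg (by positivity), inv_inv,
      Real.mul_rpow (by norm_num) ht.le, Real.rpow_sub (by norm_num), Real.rpow_one]
    field_simp
  constructor
  rw [Measure.real, ENNReal.toReal_eq_one_iff] at h1
  exact h1

lemma besselLaw_moments {d : ℕ} (hd : 1 ≤ d) {t : ℝ} (ht : 0 < t) (k : ℕ) :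
    ∫ s, s ^ (k + 2) ∂besselLaw d t = t * (d + k) * ∫ s, s ^ k ∂besselLaw d t := by
  have hd' : (1 : ℝ) ≤ d := by exact_mod_cast hd
  rw [integral_besselLaw_pow hd ht, integral_besselLaw_pow hd ht]
  have e1 : (d : ℝ) - 1 + (k + 2 : ℕ) + 1 = (d + k) + 2 := by push_cast; ring
  have e2 : (d : ℝ) - 1 + k + 1 = d + k := by ring
  have hpos : 0 < (d + k : ℝ) / 2 := by positivity
  rw [e1, e2, show ((d + k : ℝ) + 2) / 2 = (d + k) / 2 + 1 by ring, Real.Gamma_add_one hpos.ne',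
    show -((d + k : ℝ) + 2) / 2 = -(d + k) / 2 + (-1) by ring,
    Real.rpow_add (by positivity), Real.rpow_neg_one]
  field_simp

lemma ae_pos_besselLaw (d : ℕ) (t : ℝ) : ∀ᵐ s ∂besselLaw d t, 0 < s := by
  rw [besselLaw]
  refine Measure.ae_smul_measure ?_ _
  exact (withDensity_absolutelyContinuous _ _).ae_le (ae_restrict_mem measurableSet_Ioi)

lemma integrable_exp_besselLaw {d : ℕ} (hd : 1 ≤ d) {t : ℝ} (ht : 0 < t) (a : ℝ) :
    Integrable (fun s => Real.exp (a * s)) (besselLaw d t) := by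
  have hd' : (1 : ℝ) ≤ d := by exact_mod_cast hd
  rw [besselLaw]
  refine Integrable.smul_measure ?_ ENNReal.ofReal_ne_top
  rw [integrable_withDensity_iff_integrable_smul' (measurable_besselWeight d t).ennreal_ofReal
    (by simp)]
  have hi := integrableOn_rpow_mul_exp_neg_mul_sq (b := 1 / (4 * t)) (by positivity)
    (s := (d : ℝ) - 1) (by linarith)
  refine Integrable.mono' (hi.const_mul (Real.exp (a ^ 2 * t) / t ^ ((d : ℝ) / 2))) ?_ ?_
  · refine Measurable.aestronglyMeasurable ?_
    have := measurable_besselWeight d t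
    fun_prop
  · filter_upwards [ae_restrict_mem measurableSet_Ioi] with s hs
    have hs : 0 < s := hs
    rw [ENNReal.toReal_ofReal (besselWeight_nonneg d ht.le hs.le), besselWeight, smul_eq_mul,
      Real.norm_of_nonneg (by positivity)]
    -- Half of the Gaussian exponent is spent on absorbing `a * s`, by completing the square: `a * s
    -- ≤ a ^ 2 * t + s ^ 2 / (4 * t)`.
    have : Real.exp (-s ^ 2 / (2 * t)) * Real.exp (a * s) ≤
        Real.exp (a ^ 2 * t) * Real.exp (-(1 / (4 * t)) * s ^ 2) := by
      rw [← Real.exp_add, ← Real.exp_add, Real.exp_le_exp]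
      have : a ^ 2 * t + -(1 / (4 * t)) * s ^ 2 - (-s ^ 2 / (2 * t) + a * s) =
          (s - 2 * t * a) ^ 2 / (4 * t) := by
        field_simp
        ring
      have h2 : 0 ≤ (s - 2 * t * a) ^ 2 / (4 * t) := by positivity
      linarith
    calc _ = s ^ ((d : ℝ) - 1) / t ^ ((d : ℝ) / 2) *
          (Real.exp (-s ^ 2 / (2 * t)) * Real.exp (a * s)) := by ring
      _ ≤ s ^ ((d : ℝ) - 1) / t ^ ((d : ℝ) / 2) *
          (Real.exp (a ^ 2 * t) * Real.exp (-(1 / (4 * t)) * s ^ 2)) := by gcongr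
      _ = _ := by ring

lemma lintegral_betaMeasure (α β : ℝ) {f : ℝ → ℝ≥0∞} (hf : Measurable f) :
    ∫⁻ w, f w ∂betaMeasure α β = ∫⁻ w in Set.Ioo (0 : ℝ) 1,
      ENNReal.ofReal (1 / beta α β * w ^ (α - 1) * (1 - w) ^ (β - 1)) * f w := by
  have hm : Measurable (betaPDF α β) := (measurable_betaPDFReal α β).ennreal_ofReal
  rw [betaMeasure, lintegral_withDensity_eq_lintegral_mul _ hm hf,
    ← lintegral_indicator measurableSet_Ioo]
  refine lintegral_congr fun w => ?_
  rw [Pi.mul_apply]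
  by_cases hw : w ∈ Set.Ioo (0 : ℝ) 1
  · rw [Set.indicator_of_mem hw, betaPDF_of_pos_lt_one hw.1 hw.2]
  · rw [Set.indicator_of_notMem hw, betaPDF_eq, if_neg (show ¬(0 < w ∧ w < 1) from hw)]
    simp

lemma ae_mem_Ioo_betaMeasure (α β : ℝ) : ∀ᵐ w ∂betaMeasure α β, w ∈ Set.Ioo (0 : ℝ) 1 := by
  rw [ae_iff]
  have hms : MeasurableSet {w : ℝ | w ∉ Set.Ioo (0 : ℝ) 1} := measurableSet_Ioo.compl
  rw [← lintegral_indicator_one hms, lintegral_betaMeasure _ _ (measurable_one.indicator hms)]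
  refine (setLIntegral_congr_fun measurableSet_Ioo fun w hw => ?_).trans lintegral_zero
  rw [Set.indicator_of_notMem (by simpa using hw), mul_zero]

lemma integral_sqrt_pow_betaMeasure {α β : ℝ} (hα : 0 < α) (hβ : 0 < β) (k : ℕ) :
    ∫ w, √w ^ k ∂betaMeasure α β = beta (α + k / 2) β / beta α β := by
  have hα' : 0 < α + k / 2 := by positivity
  rw [integral_eq_lintegral_of_nonneg_ae (Filter.Eventually.of_forall fun w => by positivity)
    (by fun_prop), lintegral_betaMeasure _ _ (by fun_prop)]
  have h1 : ∫⁻ w in Set.Ioo (0 : ℝ) 1,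
      ENNReal.ofReal (1 / beta α β * w ^ (α - 1) * (1 - w) ^ (β - 1)) * ENNReal.ofReal (√w ^ k) =
      ENNReal.ofReal (beta (α + k / 2) β / beta α β) := by
    have h2 := lintegral_betaPDF_eq_one hα' hβ
    rw [lintegral_betaPDF] at h2
    have hb := beta_pos hα hβ
    have hb' := beta_pos hα' hβ
    rw [← mul_one (ENNReal.ofReal (beta (α + k / 2) β / beta α β)), ← h2,
      ← lintegral_const_mul _ (by fun_prop)]
    refine setLIntegral_congr_fun measurableSet_Ioo fun w hw => ?_
    have hw0 : 0 < w := hw.1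
    have hw1 : 0 < 1 - w := by linarith [hw.2]
    rw [← ENNReal.ofReal_mul (by positivity), ← ENNReal.ofReal_mul (by positivity)]
    congr 1
    have : √w ^ k = w ^ ((k : ℝ) / 2) := by
      rw [Real.sqrt_eq_rpow, ← Real.rpow_natCast, ← Real.rpow_mul hw0.le]
      congr 1
      ring
    rw [this, show α + k / 2 - 1 = (α - 1) + k / 2 by ring, Real.rpow_add hw0]
    generalize beta (α + k / 2) β = b at hb'
    field_simp
  rw [h1, ENNReal.toReal_ofReal (div_nonneg (beta_pos hα' hβ).le (beta_pos hα hβ).le)]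

/-- Moments of `√w` are needed because the square root is what multiplies the Gaussian. Raising `k`
by two raises the first beta parameter by one, and `Γ(x + 1) = x Γ(x)` gives the ratio. -/
lemma betaMeasure_moments {α β : ℝ} (hα : 0 < α) (hβ : 0 < β) (k : ℕ) :
    (2 * α + 2 * β + k) * ∫ w, √w ^ (k + 2) ∂betaMeasure α β =
      (2 * α + k) * ∫ w, √w ^ k ∂betaMeasure α β := by
  rw [integral_sqrt_pow_betaMeasure hα hβ, integral_sqrt_pow_betaMeasure hα hβ]
  have hα' : 0 < α + k / 2 := by positivity
  have e : α + ((k + 2 : ℕ) : ℝ) / 2 = α + k / 2 + 1 := by push_cast; ring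
  have h1 : 0 < α + k / 2 + β := by positivity
  have h3 := Real.Gamma_pos_of_pos h1
  have h4 := (beta_pos hα hβ).ne'
  rw [e, show 2 * α + 2 * β + k = 2 * (α + k / 2 + β) by ring,
    show 2 * α + k = 2 * (α + k / 2) by ring]
  generalize α + k / 2 = γ at *
  unfold beta at *
  rw [show γ + 1 + β = γ + β + 1 by ring, Real.Gamma_add_one hα'.ne', Real.Gamma_add_one h1.ne']
  field_simp

/-! ### The Bessel and beta-Gaussian product identity -/

/-- The product of a Bessel variable and an independent variable with law `unitLaw` is distributed
as the product of the square root of a beta variable and an independent Gaussian variable. -/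
theorem besselLaw_mul_unitLaw {c : ℝ} (hc : 0 < c) (m : Fin 2)
    [IsProbabilityMeasure (angleMeasure ((m : ℕ) : ℝ))] {d n : ℕ} (hd : 1 ≤ d)
    (hv : (d : ℝ) / 2 - 1 < vParam m n) {t : ℝ} (ht : 0 < t) :
    ((besselLaw d t).prod (unitLaw c (angleMeasure ((m : ℕ) : ℝ)) n)).map (fun p => p.1 * p.2) =
      ((betaMeasure ((d : ℝ) / 2) (vParam m n - (d : ℝ) / 2 + 1)).prod (gaussianReal 0 1)).map
        (fun p => c * √t * √p.1 * p.2) := by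
  have hd' : (1 : ℝ) ≤ d := by exact_mod_cast hd
  have hα : 0 < (d : ℝ) / 2 := by positivity
  have hβ : 0 < vParam m n - (d : ℝ) / 2 + 1 := by linarith
  have i1 := isProbabilityMeasure_besselLaw hd ht
  have i2 := isProbabilityMeasureBeta hα hβ
  set K := unitLaw c (angleMeasure ((m : ℕ) : ℝ)) n
  have i3 := Measure.isProbabilityMeasure_map (μ := (besselLaw d t).prod K)
    (f := fun p => p.1 * p.2) (by fun_prop)
  have i4 := Measure.isProbabilityMeasure_map
    (μ := (betaMeasure ((d : ℝ) / 2) (vParam m n - (d : ℝ) / 2 + 1)).prod (gaussianReal 0 1))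
    (f := fun p => c * √t * √p.1 * p.2) (by fun_prop)
  -- Exponential integrability holds on the left because `|Y| ≤ c` and the Bessel law has Gaussian
  -- tails, and on the right because `√W ≤ 1`.
  refine ext_of_integral_pow_eq (fun a => ?_) (fun a => ?_) (fun k => ?_)
  · rw [integrable_map_measure (by fun_prop) (by fun_prop)]
    refine Integrable.mono' ((integrable_exp_besselLaw hd ht (|a| * c)).comp_fst K) (by fun_prop) ?_
    have h1 := (Measure.quasiMeasurePreserving_fst (μ := besselLaw d t) (ν := K)).ae
      (ae_pos_besselLaw d t)
    have h2 := (Measure.quasiMeasurePreserving_snd (μ := besselLaw d t) (ν := K)).ae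
      (ae_abs_le_unitLaw hc _ n)
    filter_upwards [h1, h2] with p h1 h2
    rw [Function.comp, Real.norm_of_nonneg (by positivity), Real.exp_le_exp]
    calc a * (p.1 * p.2) ≤ |a * (p.1 * p.2)| := le_abs_self _
      _ = |a| * (p.1 * |p.2|) := by rw [abs_mul, abs_mul, abs_of_pos h1]
      _ ≤ |a| * (p.1 * c) := by gcongr
      _ = _ := by ring
  · rw [integrable_map_measure (by fun_prop) (by fun_prop)]
    have hi : Integrable (fun x => Real.exp (|a| * (c * √t) * |x|)) (gaussianReal 0 1) :=
      integrable_exp_mul_abs (X := fun x => x) (integrable_exp_mul_gaussianReal _)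
        (integrable_exp_mul_gaussianReal _)
    refine Integrable.mono' (hi.comp_snd _) (by fun_prop) ?_
    have h1 := (Measure.quasiMeasurePreserving_fst
      (μ := betaMeasure ((d : ℝ) / 2) (vParam m n - (d : ℝ) / 2 + 1)) (ν := gaussianReal 0 1)).ae
      (ae_mem_Ioo_betaMeasure _ _)
    filter_upwards [h1] with p h1
    rw [Function.comp, Real.norm_of_nonneg (by positivity), Real.exp_le_exp]
    have h3 : √p.1 ≤ 1 := Real.sqrt_le_one.2 h1.2.le
    calc a * (c * √t * √p.1 * p.2) ≤ |a * (c * √t * √p.1 * p.2)| := le_abs_self _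
      _ = |a| * (c * √t * √p.1 * |p.2|) := by
        rw [abs_mul, abs_mul, abs_of_nonneg (by positivity : 0 ≤ c * √t * √p.1)]
      _ ≤ |a| * (c * √t * 1 * |p.2|) := by gcongr
      _ = _ := by ring
  · rw [integral_map (by fun_prop) (by fun_prop), integral_map (by fun_prop) (by fun_prop)]
    simp_rw [mul_pow, mul_assoc ((c ^ k * √t ^ k))]
    rw [integral_const_mul, integral_prod_mul (fun x : ℝ => x ^ k) (fun x : ℝ => x ^ k),
      integral_prod_mul (fun x : ℝ => √x ^ k) (fun x : ℝ => x ^ k)]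
    obtain ⟨hK1, hK⟩ := unitLaw_moments hc m n
    obtain ⟨hZ1, hZ⟩ := gaussian_moments
    have hv2 : 0 < 2 * vParam m n + 2 := by linarith
    -- Both moment sequences start with `1, 0` and have the two-step ratio `c² t (d + k) (k + 1) /
    -- (2 v_m + 2 + k)`.
    induction k using Nat.twoStepInduction with
    | zero => simp
    | one => rw [hZ1, hK1]; simp
    | more k ih _ =>
      have hKk := hK k
      have hβk := betaMeasure_moments hα hβ k
      rw [besselLaw_moments hd ht, hZ]
      have h0 : (2 * vParam m n + 2 + k : ℝ) ≠ 0 := by positivity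
      refine mul_left_cancel₀ h0 ?_
      have hst : √t ^ 2 = t := Real.sq_sqrt ht.le
      have hβk' : (2 * vParam m n + 2 + k) * ∫ w, √w ^ (k + 2)
          ∂betaMeasure ((d : ℝ) / 2) (vParam m n - (d : ℝ) / 2 + 1) =
          (d + k) * ∫ w, √w ^ k ∂betaMeasure ((d : ℝ) / 2) (vParam m n - (d : ℝ) / 2 + 1) := by
        linear_combination hβk
      rw [pow_add c, pow_add (√t), hst]
      generalize ∫ w, √w ^ (k + 2) ∂betaMeasure _ _ = b' at *
      generalize ∫ w, √w ^ k ∂betaMeasure _ _ = b at *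
      generalize ∫ y, y ^ (k + 2) ∂K = y' at *
      generalize ∫ y, y ^ k ∂K = y at *
      generalize ∫ s, s ^ k ∂besselLaw d t = R at *
      generalize ∫ x, x ^ k ∂gaussianReal 0 1 = z at *
      linear_combination (t * (d + k) * R) * hKk + (t * (d + k) * c ^ 2 * (k + 1)) * ih
        - (c ^ k * c ^ 2 * √t ^ k * t * (k + 1) * z) * hβk'

/-- The mixture over a Bessel clock of the conditional laws of the motion has the density
`betaGaussIntegral`, up to normalization. -/
theorem lintegral_besselWeight_unitLaw {c : ℝ} (hc : 0 < c) (m : Fin 2)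
    [IsProbabilityMeasure (angleMeasure ((m : ℕ) : ℝ))] {d n : ℕ} (hd : 1 ≤ d)
    (hv : (d : ℝ) / 2 - 1 < vParam m n) {t : ℝ} (ht : 0 < t) {f : ℝ → ℝ≥0∞} (hf : Measurable f) :
    ∫⁻ s, ∫⁻ y, f (s * y) ∂unitLaw c (angleMeasure ((m : ℕ) : ℝ)) n ∂besselLaw d t =
      ENNReal.ofReal (1 / beta ((d : ℝ) / 2) (vParam m n - (d : ℝ) / 2 + 1)) *
        ∫⁻ x, f x * betaGaussIntegral d (vParam m n) c x t := by
  have hd' : (1 : ℝ) ≤ d := by exact_mod_cast hd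
  have hα : 0 < (d : ℝ) / 2 := by positivity
  have hβ : 0 < vParam m n - (d : ℝ) / 2 + 1 := by linarith
  have hb := beta_pos hα hβ
  have h := congrArg (fun μ : Measure ℝ => ∫⁻ x, f x ∂μ) (besselLaw_mul_unitLaw hc m hd hv ht)
  rw [lintegral_map hf (by fun_prop), lintegral_map hf (by fun_prop),
    lintegral_prod _ (by fun_prop), lintegral_prod _ (by fun_prop)] at h
  rw [h, lintegral_betaMeasure _ _ (by fun_prop)]
  -- For fixed `w`, the variable `c √t √w Z` is centred Gaussian with variance `c² t w`; its density
  -- is the kernel in `betaGaussIntegral`.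
  have hin : ∀ w ∈ Set.Ioo (0 : ℝ) 1,
      ENNReal.ofReal (1 / beta ((d : ℝ) / 2) (vParam m n - (d : ℝ) / 2 + 1) *
        w ^ ((d : ℝ) / 2 - 1) * (1 - w) ^ (vParam m n - (d : ℝ) / 2 + 1 - 1)) *
        ∫⁻ z, f (c * √t * √w * z) ∂gaussianReal 0 1 =
      ENNReal.ofReal (1 / beta ((d : ℝ) / 2) (vParam m n - (d : ℝ) / 2 + 1)) *
        ∫⁻ x, f x * ENNReal.ofReal
          (w ^ ((d : ℝ) / 2 - 1) * (1 - w) ^ (vParam m n - (d : ℝ) / 2) *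
          (Real.exp (-x ^ 2 / (2 * c ^ 2 * t * w)) / (√(2 * Real.pi * t * w) * c))) := by
    intro w hw
    have hw0 : 0 < w := hw.1
    have hw1 : 0 < 1 - w := by linarith [hw.2]
    have hk : 0 < c * √t * √w := by positivity
    have hg := gaussianReal_map_const_mul (μ := 0) (v := 1) (c * √t * √w)
    have hvar : (NNReal.mk ((c * √t * √w) ^ 2) (sq_nonneg _) * 1 : ℝ≥0) ≠ 0 := by
      rw [mul_one, ← NNReal.coe_ne_zero]
      exact (pow_pos hk 2).ne'
    have hsq : (c * √t * √w) ^ 2 = c ^ 2 * t * w := by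
      rw [mul_pow, mul_pow, Real.sq_sqrt ht.le, Real.sq_sqrt hw0.le]
    rw [← lintegral_map (f := f) (g := fun z => c * √t * √w * z) hf (by fun_prop), hg,
      gaussianReal_of_var_ne_zero _ hvar,
      lintegral_withDensity_eq_lintegral_mul _ (measurable_gaussianPDF _ _) hf,
      ← lintegral_const_mul _ (by fun_prop), ← lintegral_const_mul _ (by fun_prop)]
    refine lintegral_congr fun x => ?_
    rw [Pi.mul_apply, gaussianPDF, gaussianPDFReal, mul_comm (f x), ← mul_assoc, ← mul_assoc,
      ← ENNReal.ofReal_mul (by positivity), ← ENNReal.ofReal_mul (by positivity)]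
    congr 2
    have hco : ((NNReal.mk ((c * √t * √w) ^ 2) (sq_nonneg _) * 1 : ℝ≥0) : ℝ) = c ^ 2 * t * w := by
      rw [mul_one, ← hsq]; rfl
    have hs : √(2 * Real.pi * (c ^ 2 * t * w)) = √(2 * Real.pi * t * w) * c := by
      rw [show 2 * Real.pi * (c ^ 2 * t * w) = 2 * Real.pi * t * w * c ^ 2 by ring,
        Real.sqrt_mul (by positivity), Real.sqrt_sq hc.le]
    rw [hco, hs, show vParam m n - (d : ℝ) / 2 + 1 - 1 = vParam m n - (d : ℝ) / 2 by ring,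
      show -(x - c * √t * √w * 0) ^ 2 / (2 * (c ^ 2 * t * w)) = -x ^ 2 / (2 * c ^ 2 * t * w) by
        ring_nf]
    ring
  rw [setLIntegral_congr_fun measurableSet_Ioo hin, lintegral_const_mul _ (by fun_prop)]
  congr 1
  rw [lintegral_lintegral_swap (by fun_prop)]
  refine lintegral_congr fun x => ?_
  rw [betaGaussIntegral, lintegral_const_mul _ (by fun_prop)]

/-! ### The norm of a Gaussian vector -/

lemma pi_gaussianReal_eq_withDensity (d : ℕ) {s : ℝ≥0} (hs : s ≠ 0) :
    Measure.pi (fun _ : Fin d => gaussianReal 0 s) =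
      volume.withDensity fun x => ENNReal.ofReal (∏ i, gaussianPDFReal 0 s (x i)) := by
  refine Measure.pi_eq fun S hS => ?_
  rw [withDensity_apply _ (MeasurableSet.univ_pi hS), volume_pi, Measure.restrict_pi_pi,
    ← ofReal_integral_eq_lintegral_ofReal]
  · rw [integral_fintype_prod_eq_prod, ENNReal.ofReal_prod_of_nonneg]
    · refine Finset.prod_congr rfl fun i _ => ?_
      rw [gaussianReal_apply_eq_integral _ hs]
    · intro i _
      exact integral_nonneg fun x => gaussianPDFReal_nonneg _ _ _
  · exact Integrable.fintype_prod fun i => (integrable_gaussianPDFReal 0 s).restrict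
  · exact Filter.Eventually.of_forall fun x =>
      Finset.prod_nonneg fun i _ => gaussianPDFReal_nonneg _ _ _

/-- Polar coordinates; the origin can be removed because it is a null set. -/
lemma lintegral_fun_norm_addHaar {E : Type*} [NormedAddCommGroup E] [NormedSpace ℝ E]
    [Nontrivial E] [MeasurableSpace E] (μ : Measure E) [FiniteDimensional ℝ E] [BorelSpace E]
    [μ.IsAddHaarMeasure] {f : ℝ → ℝ≥0∞} (hf : Measurable f) :
    ∫⁻ x, f ‖x‖ ∂μ = μ.toSphere Set.univ *
      ∫⁻ y in Set.Ioi (0 : ℝ), ENNReal.ofReal (y ^ (Module.finrank ℝ E - 1)) * f y :=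
  calc
    ∫⁻ x, f ‖x‖ ∂μ = ∫⁻ x : ({(0)}ᶜ : Set E), f ‖x.1‖ ∂(μ.comap (↑)) := by
      rw [lintegral_subtype_comap (measurableSet_singleton _).compl fun x => f ‖x‖,
        restrict_compl_singleton]
    _ = ∫⁻ x, f x.2 ∂μ.toSphere.prod (.volumeIoiPow (Module.finrank ℝ E - 1)) := by
      have := μ.measurePreserving_homeomorphUnitSphereProd.lintegral_comp
        (f := fun x => f x.2) (by fun_prop)
      simpa using this
    _ = μ.toSphere Set.univ *
        ∫⁻ x : Set.Ioi (0 : ℝ), f x ∂.volumeIoiPow (Module.finrank ℝ E - 1) := by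
      rw [lintegral_prod _ (by fun_prop)]
      simp only [lintegral_const]
      rw [mul_comm]
    _ = _ := by
      rw [Measure.volumeIoiPow, lintegral_withDensity_eq_lintegral_mul _ (by fun_prop)
        (by fun_prop)]
      congr 1
      exact lintegral_subtype_comap measurableSet_Ioi
        fun y : ℝ => ENNReal.ofReal (y ^ (Module.finrank ℝ E - 1)) * f y

/-- The norm of a centred Gaussian vector with independent components has law `besselLaw`. -/
theorem lintegral_norm_pi_gaussianReal {d : ℕ} (hd : 1 ≤ d) {s : ℝ≥0} (hs : 0 < s) {f : ℝ → ℝ≥0∞}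
    (hf : Measurable f) :
    ∫⁻ x, f (√(∑ i, x i ^ 2)) ∂Measure.pi (fun _ : Fin d => gaussianReal 0 s) =
      ∫⁻ y, f y ∂besselLaw d s := by
  have hs' : (0 : ℝ) < s := by exact_mod_cast hs
  have hd' : (1 : ℝ) ≤ d := by exact_mod_cast hd
  have hG : 0 < Real.Gamma ((d : ℝ) / 2) := Real.Gamma_pos_of_pos (by positivity)
  have : Nonempty (Fin d) := ⟨⟨0, by omega⟩⟩
  -- Polar coordinates are used only up to a constant. Since both sides are integrals against
  -- probability measures, `f = 1` forces `C = 1`, and the area of the sphere is never computed.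
  obtain ⟨C, hC⟩ : ∃ C : ℝ≥0∞, ∀ f : ℝ → ℝ≥0∞, Measurable f →
      ∫⁻ x, f (√(∑ i, x i ^ 2)) ∂Measure.pi (fun _ : Fin d => gaussianReal 0 s) =
      C * ∫⁻ y, f y ∂besselLaw d s := by
    set k : ℝ := (√(2 * Real.pi * s))⁻¹ ^ d with hk
    set G : ℝ := 1 / (Real.Gamma ((d : ℝ) / 2) * 2 ^ ((d : ℝ) / 2 - 1)) with hGdef
    have hk0 : 0 < k := by positivity
    have hG0 : 0 < G := by positivity
    refine ⟨(volume : Measure (EuclideanSpace ℝ (Fin d))).toSphere Set.univ *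
      ENNReal.ofReal (k * s ^ ((d : ℝ) / 2) / G), fun f hf => ?_⟩
    rw [pi_gaussianReal_eq_withDensity d hs.ne', lintegral_withDensity_eq_lintegral_mul _
      (by fun_prop) (by fun_prop)]
    have h1 := (PiLp.volume_preserving_ofLp (Fin d)).lintegral_comp
      (f := (fun x : Fin d → ℝ => ENNReal.ofReal (∏ i, gaussianPDFReal 0 s (x i))) *
        fun x : Fin d → ℝ => f (√(∑ i, x i ^ 2))) (by fun_prop)
    rw [← h1]
    have h2 (x : EuclideanSpace ℝ (Fin d)) :
        ((fun x : Fin d → ℝ => ENNReal.ofReal (∏ i, gaussianPDFReal 0 s (x i))) *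
          fun x : Fin d → ℝ => f (√(∑ i, x i ^ 2))) (WithLp.ofLp x) =
        (fun y : ℝ => ENNReal.ofReal (k * Real.exp (-y ^ 2 / (2 * s))) * f y) ‖x‖ := by
      have hn : ‖x‖ = √(∑ i, x i ^ 2) := by
        rw [EuclideanSpace.norm_eq]
        simp
      have hprod : ∏ i, gaussianPDFReal 0 s (x i) = k * Real.exp (-‖x‖ ^ 2 / (2 * s)) := by
        simp only [gaussianPDFReal, Finset.prod_mul_distrib, Finset.prod_const, Finset.card_univ,
          Fintype.card_fin, sub_zero]
        rw [← Real.exp_sum, hn, Real.sq_sqrt (by positivity), ← Finset.sum_div,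
          Finset.sum_neg_distrib]
      rw [Pi.mul_apply, hprod, ← hn]
    simp_rw [h2]
    rw [lintegral_fun_norm_addHaar volume (f := fun y : ℝ =>
      ENNReal.ofReal (k * Real.exp (-y ^ 2 / (2 * s))) * f y) (by fun_prop),
      lintegral_besselLaw _ _ hf, mul_assoc]
    congr 1
    have hw := measurable_besselWeight d s
    rw [← mul_assoc, ← ENNReal.ofReal_mul (by positivity), ← lintegral_const_mul _ (by fun_prop)]
    refine setLIntegral_congr_fun measurableSet_Ioi fun y (hy : 0 < y) => ?_
    rw [← mul_assoc, ← mul_assoc, ← ENNReal.ofReal_mul (by positivity),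
      ← ENNReal.ofReal_mul (by positivity), finrank_euclideanSpace_fin]
    congr 2
    have hpow : y ^ (d - 1) = y ^ ((d : ℝ) - 1) := by
      rw [← Real.rpow_natCast, Nat.cast_sub hd, Nat.cast_one]
    rw [besselWeight, hpow, ← hGdef]
    field_simp
  have h1 := hC (fun _ => 1) measurable_const
  have := isProbabilityMeasure_besselLaw hd hs'
  simp only [lintegral_const, measure_univ, mul_one] at h1
  rw [hC f hf, ← h1, one_mul]

/-! ### A measurable version of the iterated Bessel process -/

/-- The value at `s` of a continuous path, as a function which is measurable on the space of all
paths. -/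
def pathEval (p : ℝ≥0 → ℝ) (s : ℝ≥0) : ℝ :=
  Filter.limsup (fun k : ℕ => p ((⌊((k : ℝ) + 1) * s⌋₊ : ℝ≥0) / (k + 1))) Filter.atTop

lemma pathEval_of_continuous {p : ℝ≥0 → ℝ} (hp : Continuous p) (s : ℝ≥0) : pathEval p s = p s := by
  have h1 : Filter.Tendsto (fun k : ℕ => (⌊((k : ℝ) + 1) * s⌋₊ : ℝ≥0) / ((k : ℝ≥0) + 1))
      Filter.atTop (nhds s) := by
    rw [← NNReal.tendsto_coe]
    have h2 : Filter.Tendsto (fun k : ℕ => (k : ℝ) + 1) Filter.atTop Filter.atTop :=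
      Filter.tendsto_atTop_add_const_right _ _ tendsto_natCast_atTop_atTop
    refine ((tendsto_nat_floor_mul_div_atTop s.2).comp h2).congr fun k => ?_
    simp only [Function.comp, NNReal.coe_div, NNReal.coe_natCast, NNReal.coe_add, NNReal.coe_one,
      mul_comm ((k : ℝ) + 1)]
    rfl
  exact ((hp.tendsto s).comp h1).limsup_eq

/-- Plain evaluation `(p, s) ↦ p s` is not jointly measurable for the product σ-algebra on all
paths. Each approximating time takes countably many values, so only coordinate projections enter. -/
lemma measurable_pathEval {Z : Type*} [MeasurableSpace Z] {p : Z → ℝ≥0 → ℝ} {s : Z → ℝ≥0}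
    (hp : Measurable p) (hs : Measurable s) : Measurable fun z => pathEval (p z) (s z) := by
  unfold pathEval
  refine Measurable.limsup fun k => ?_
  have h1 : Measurable fun q : (ℝ≥0 → ℝ) × ℕ => q.1 ((q.2 : ℝ≥0) / (k + 1)) :=
    measurable_from_prod_countable_left fun j => measurable_pi_apply ((j : ℝ≥0) / (k + 1))
  have h2 : Measurable fun z => (p z, ⌊((k : ℝ) + 1) * s z⌋₊) :=
    hp.prodMk (Nat.measurable_floor.comp (by fun_prop))
  exact h1.comp h2

/-- The distance from the origin at time `s` of a continuous `d`-tuple of paths. -/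
def radius {d : ℕ} (b : Fin d → ℝ≥0 → ℝ) (s : ℝ≥0) : ℝ≥0 :=
  Real.toNNReal √(∑ i, pathEval (b i) s ^ 2)

lemma measurable_radius {Z : Type*} [MeasurableSpace Z] {d : ℕ} {b : Z → Fin d → ℝ≥0 → ℝ}
    {s : Z → ℝ≥0} (hb : Measurable b) (hs : Measurable s) :
    Measurable fun z => radius (b z) (s z) := by
  have h (i : Fin d) : Measurable fun z => pathEval (b z i) (s z) :=
    measurable_pathEval ((measurable_pi_apply i).comp hb) hs
  exact (Finset.measurable_sum _ fun i _ => (h i).pow_const 2).sqrt.real_toNNReal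

/-- The iterated Bessel process as a function of the underlying paths. -/
def clock {d : ℕ} : (l : ℕ) → (Fin (l + 1) → Fin d → ℝ≥0 → ℝ) → ℝ≥0 → ℝ≥0
  | 0, b, t => radius (b 0) t
  | l + 1, b, t => radius (b 0) (clock l (fun j => b j.succ) t)

lemma measurable_clock {d : ℕ} (l : ℕ) (t : ℝ≥0) :
    Measurable fun b : Fin (l + 1) → Fin d → ℝ≥0 → ℝ => clock l b t := by
  induction l with
  | zero => exact measurable_radius (measurable_pi_apply 0) measurable_const
  | succ l ih =>
    have h : Measurable fun b : Fin (l + 2) → Fin d → ℝ≥0 → ℝ => fun j : Fin (l + 1) => b j.succ :=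
      measurable_pi_lambda _ fun j => measurable_pi_apply _
    exact measurable_radius (measurable_pi_apply 0) (ih.comp h)

section Clock

variable {Ω : Type*}

lemma radius_eq_bessel {d : ℕ} {B : Fin d → ℝ≥0 → Ω → ℝ} {ω : Ω}
    (hω : ∀ i, Continuous fun s => B i s ω) (s : ℝ≥0) :
    radius (fun i s => B i s ω) s = bessel B s ω := by
  refine NNReal.eq ?_
  rw [radius, Real.coe_toNNReal _ (Real.sqrt_nonneg _)]
  simp only [bessel, fun i => pathEval_of_continuous (hω i) s]
  rfl

lemma clock_eq_iteratedBessel {d : ℕ} (l : ℕ) {B : Fin (l + 1) → Fin d → ℝ≥0 → Ω → ℝ} {ω : Ω}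
    (hω : ∀ j i, Continuous fun s => B j i s ω) (t : ℝ≥0) :
    clock l (fun j i s => B j i s ω) t = iteratedBessel l B t ω := by
  induction l with
  | zero => exact radius_eq_bessel (hω 0) t
  | succ l ih =>
    rw [clock, iteratedBessel, radius_eq_bessel (hω 0)]
    congr 1
    exact ih fun j i => hω j.succ i

variable [MeasurableSpace Ω] {P : Measure Ω}

/-- Brownian paths are almost surely continuous, and on continuous paths `pathEval` is evaluation.
Measurability and independence can therefore be read off from `clock`. -/
lemma iteratedBessel_ae_eq_clock {d l : ℕ} {B : Fin (l + 1) → Fin d → ℝ≥0 → Ω → ℝ}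
    (hB : ∀ j i, IsBrownianReal (B j i) P) (t : ℝ≥0) :
    iteratedBessel l B t =ᵐ[P] fun ω => clock l (fun j i s => B j i s ω) t := by
  have : ∀ᵐ ω ∂P, ∀ j i, Continuous fun s => B j i s ω :=
    ae_all_iff.2 fun j => ae_all_iff.2 fun i => (hB j i).cont
  filter_upwards [this] with ω hω using (clock_eq_iteratedBessel l hω t).symm

/-- The law of a Bessel process at a fixed time. -/
lemma lintegral_bessel [IsProbabilityMeasure P] {d : ℕ} (hd : 1 ≤ d) {B : Fin d → ℝ≥0 → Ω → ℝ}
    (hBm : ∀ i s, Measurable (B i s)) (hB : ∀ i, IsBrownianReal (B i) P)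
    (hBi : iIndepFun (fun i ω (s : ℝ≥0) => B i s ω) P) {s : ℝ≥0} (hs : 0 < s)
    {f : ℝ → ℝ≥0∞} (hf : Measurable f) :
    ∫⁻ ω, f (bessel B s ω) ∂P = ∫⁻ y, f y ∂besselLaw d s := by
  rw [← lintegral_norm_pi_gaussianReal hd hs hf]
  have hi : iIndepFun (fun i => B i s) P :=
    hBi.comp (fun _ p => p s) fun _ => measurable_pi_apply s
  have hmap : P.map (fun ω i => B i s ω) = Measure.pi (fun _ : Fin d => gaussianReal 0 s) := by
    rw [(iIndepFun_iff_map_fun_eq_pi_map fun i => (hBm i s).aemeasurable).1 hi]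
    congr 1
    funext i
    exact ((hB i).hasLaw_eval s).map_eq
  rw [← hmap, lintegral_map (by fun_prop) (by fun_prop)]
  rfl

end Clock

/-! ### Manipulation of nested integrals -/

lemma nestedIntegral_succ (d : ℕ) (g : ℝ → ℝ≥0∞) (l : ℕ) (t : ℝ) :
    nestedIntegral d g (l + 1) t =
      ∫⁻ s in Set.Ioi (0 : ℝ), ENNReal.ofReal (besselWeight d t s) * nestedIntegral d g l s := rfl

/-- All integration variables are positive, so identities valid only at positive times may be used
inside. -/
lemma nestedIntegral_congr (d : ℕ) {g h : ℝ → ℝ≥0∞} (hgh : ∀ s, 0 < s → g s = h s) (l : ℕ) {t : ℝ}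
    (ht : 0 < t) : nestedIntegral d g l t = nestedIntegral d h l t := by
  induction l generalizing t with
  | zero => exact hgh t ht
  | succ l ih =>
    rw [nestedIntegral_succ, nestedIntegral_succ]
    exact setLIntegral_congr_fun measurableSet_Ioi fun s hs => by rw [ih hs]

lemma nestedIntegral_const_mul (d : ℕ) {k : ℝ≥0∞} (hk : k ≠ ∞) (g : ℝ → ℝ≥0∞) (l : ℕ) (t : ℝ) :
    nestedIntegral d (fun s => k * g s) l t = k * nestedIntegral d g l t := by
  induction l generalizing t with
  | zero => rfl
  | succ l ih =>
    rw [nestedIntegral_succ, nestedIntegral_succ, ← lintegral_const_mul' _ _ hk]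
    refine lintegral_congr fun s => ?_
    rw [ih, mul_left_comm]

/-- The innermost kernel of an iterated integral can be moved into the integrand. -/
lemma nestedIntegral_kernel (d : ℕ) (g : ℝ → ℝ≥0∞) (l : ℕ) (t : ℝ) :
    nestedIntegral d
        (fun u => ∫⁻ s in Set.Ioi (0 : ℝ), ENNReal.ofReal (besselWeight d u s) * g s) l t =
      nestedIntegral d g (l + 1) t := by
  induction l generalizing t with
  | zero => rfl
  | succ l ih =>
    rw [nestedIntegral_succ, nestedIntegral_succ]
    refine lintegral_congr fun s => ?_
    rw [ih]

lemma measurable_nestedIntegral_uncurry {Z : Type*} [MeasurableSpace Z] (d : ℕ)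
    {g : Z → ℝ → ℝ≥0∞} (hg : Measurable fun p : Z × ℝ => g p.1 p.2) (l : ℕ) :
    Measurable fun p : Z × ℝ => nestedIntegral d (g p.1) l p.2 := by
  induction l with
  | zero => exact hg
  | succ l ih =>
    simp only [nestedIntegral_succ]
    refine Measurable.lintegral_prod_right' (f := fun q : (Z × ℝ) × ℝ =>
      ENNReal.ofReal (besselWeight d q.1.2 q.2) * nestedIntegral d (g q.1.1) l q.2) ?_
    refine Measurable.mul ?_ (ih.comp (by fun_prop : Measurable
      fun q : (Z × ℝ) × ℝ => (q.1.1, q.2)))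
    exact ((measurable_besselWeight_uncurry d).comp (by fun_prop : Measurable
      fun q : (Z × ℝ) × ℝ => (q.1.2, q.2))).ennreal_ofReal

lemma measurable_nestedIntegral {Z : Type*} [MeasurableSpace Z] (d : ℕ)
    {g : Z → ℝ → ℝ≥0∞} (hg : Measurable fun p : Z × ℝ => g p.1 p.2) (l : ℕ) (t : ℝ) :
    Measurable fun z => nestedIntegral d (g z) l t :=
  (measurable_nestedIntegral_uncurry d hg l).comp (by fun_prop : Measurable fun z : Z => (z, t))

lemma nestedIntegral_lintegral {Z : Type*} [MeasurableSpace Z] (μ : Measure Z) [SFinite μ] (d : ℕ)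
    {g : Z → ℝ → ℝ≥0∞} (hg : Measurable fun p : Z × ℝ => g p.1 p.2) (l : ℕ) (t : ℝ) :
    nestedIntegral d (fun s => ∫⁻ z, g z s ∂μ) l t = ∫⁻ z, nestedIntegral d (g z) l t ∂μ := by
  induction l generalizing t with
  | zero => rfl
  | succ l ih =>
    have hm := measurable_nestedIntegral_uncurry d hg l
    have hw := measurable_besselWeight d t
    simp only [nestedIntegral_succ, ih]
    rw [lintegral_lintegral_swap]
    · refine lintegral_congr fun s => ?_
      rw [lintegral_const_mul _ (measurable_nestedIntegral d hg l s)]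
    · exact ((hw.ennreal_ofReal.comp measurable_snd).mul hm).aemeasurable

/-! ### The law of the iterated Bessel process -/

section IteratedLaw

variable {Ω : Type*} [MeasurableSpace Ω] {P : Measure Ω}

lemma measurable_lintegral_besselLaw (d : ℕ) {f : ℝ → ℝ≥0∞} (hf : Measurable f) :
    Measurable fun t => ∫⁻ s, f s ∂besselLaw d t := by
  simp only [lintegral_besselLaw d _ hf]
  refine Measurable.const_mul ?_ _
  exact Measurable.lintegral_prod_right' (f := fun q : ℝ × ℝ =>
    ENNReal.ofReal (besselWeight d q.1 q.2) * f q.2) (by fun_prop)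

lemma measurable_paths {d l : ℕ} {B : Fin (l + 1) → Fin d → ℝ≥0 → Ω → ℝ}
    (hBm : ∀ j i s, Measurable (B j i s)) : Measurable fun ω j i (s : ℝ≥0) => B j i s ω :=
  measurable_pi_lambda _ fun j => measurable_pi_lambda _ fun i => measurable_pi_lambda _ fun s =>
    hBm j i s

/-- The outermost Bessel process is independent of the ones that form its clock. -/
lemma indepFun_head_tail {d l : ℕ} {B : Fin (l + 2) → Fin d → ℝ≥0 → Ω → ℝ}
    (hBm : ∀ j i s, Measurable (B j i s))
    (hBi : iIndepFun (fun (p : Fin (l + 2) × Fin d) ω (s : ℝ≥0) => B p.1 p.2 s ω) P) :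
    IndepFun (fun ω i (s : ℝ≥0) => B 0 i s ω)
      (fun ω (j : Fin (l + 1)) i (s : ℝ≥0) => B j.succ i s ω) P := by
  classical
  let S : Finset (Fin (l + 2) × Fin d) := Finset.univ.filter fun p => p.1 = 0
  let T : Finset (Fin (l + 2) × Fin d) := Finset.univ.filter fun p => p.1 ≠ 0
  have hST : Disjoint S T := Finset.disjoint_filter_filter_not _ _ _
  have h := hBi.indepFun_finset S T hST fun p => measurable_pi_lambda _ fun s => hBm p.1 p.2 s
  have h0 (i : Fin d) : ((0 : Fin (l + 2)), i) ∈ S := by simp [S]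
  have h1 (j : Fin (l + 1)) (i : Fin d) : (j.succ, i) ∈ T := by simp [T]
  exact h.comp (φ := fun (x : S → ℝ≥0 → ℝ) i => x ⟨(0, i), h0 i⟩)
    (ψ := fun (x : T → ℝ≥0 → ℝ) j i => x ⟨(j.succ, i), h1 j i⟩)
    (measurable_pi_lambda _ fun i => measurable_pi_apply _)
    (measurable_pi_lambda _ fun j => measurable_pi_lambda _ fun i => measurable_pi_apply _)

lemma aemeasurable_iteratedBessel {d l : ℕ} {B : Fin (l + 1) → Fin d → ℝ≥0 → Ω → ℝ}
    (hBm : ∀ j i s, Measurable (B j i s)) (hB : ∀ j i, IsBrownianReal (B j i) P) (t : ℝ≥0) :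
    AEMeasurable (iteratedBessel l B t) P :=
  ((measurable_clock l t).comp (measurable_paths hBm)).aemeasurable.congr
    (iteratedBessel_ae_eq_clock hB t).symm

/-- The Bessel laws do not charge `(-∞, 0]`, so testing with its indicator gives zero. The formula
for the law of `T` is a hypothesis here, so that the lemma also applies to the induction hypothesis
of `lintegral_iteratedBessel`. -/
lemma ae_pos_of_lintegral_nestedIntegral {d l : ℕ} {T : Ω → ℝ≥0} (hT : AEMeasurable T P)
    {k : ℝ≥0∞} {t : ℝ} (h : ∀ f : ℝ → ℝ≥0∞, Measurable f → ∫⁻ ω, f (T ω) ∂P =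
      k * nestedIntegral d (fun u => ∫⁻ s, f s ∂besselLaw d u) l t) :
    ∀ᵐ ω ∂P, 0 < T ω := by
  have h0 := h ((Set.Iic 0).indicator 1) (measurable_one.indicator measurableSet_Iic)
  have h1 (u : ℝ) : ∫⁻ s, (Set.Iic (0 : ℝ)).indicator 1 s ∂besselLaw d u = 0 := by
    rw [lintegral_indicator_one measurableSet_Iic]
    have := ae_pos_besselLaw d u
    rw [ae_iff] at this
    convert this using 2
    ext s
    simp
  have h2 : nestedIntegral d (fun u => ∫⁻ s, (Set.Iic (0 : ℝ)).indicator 1 s ∂besselLaw d u)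
      l t = 0 := by
    simp_rw [h1]
    have := nestedIntegral_const_mul d ENNReal.zero_ne_top (fun _ => 0) l t
    simpa using this
  rw [h2, mul_zero] at h0
  have hm : AEMeasurable (fun ω => (Set.Iic (0 : ℝ)).indicator (1 : ℝ → ℝ≥0∞) (T ω)) P :=
    (measurable_one.indicator measurableSet_Iic).comp_aemeasurable
      (measurable_coe_nnreal_real.comp_aemeasurable hT)
  rw [lintegral_eq_zero_iff' hm] at h0
  filter_upwards [h0] with ω hω
  by_contra hcon
  have h3 : T ω = 0 := by simpa using hcon
  simp [h3] at hω

variable [IsProbabilityMeasure P]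

lemma lintegral_of_indepFun_map {X Y : Type*} [MeasurableSpace X] [MeasurableSpace Y] {U : Ω → X}
    {V : Ω → Y} (hU : Measurable U) (hV : Measurable V) (h : IndepFun U V P) {F : X × Y → ℝ≥0∞}
    (hF : Measurable F) : ∫⁻ ω, F (U ω, V ω) ∂P = ∫⁻ ω, ∫⁻ x, F (x, V ω) ∂P.map U ∂P := by
  have i1 := Measure.isProbabilityMeasure_map (μ := P) hU.aemeasurable
  have i2 := Measure.isProbabilityMeasure_map (μ := P) hV.aemeasurable
  rw [← lintegral_map (f := F) hF (hU.prodMk hV),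
    (indepFun_iff_map_prod_eq_prod_map_map hU.aemeasurable hV.aemeasurable).1 h,
    lintegral_prod_symm _ hF.aemeasurable, lintegral_map hF.lintegral_prod_left' hV]

lemma lintegral_of_indepFun {X Y : Type*} [MeasurableSpace X] [MeasurableSpace Y] {U : Ω → X}
    {V : Ω → Y} (hU : Measurable U) (hV : Measurable V) (h : IndepFun U V P) {F : X × Y → ℝ≥0∞}
    (hF : Measurable F) : ∫⁻ ω, F (U ω, V ω) ∂P = ∫⁻ ω, ∫⁻ ω', F (U ω', V ω) ∂P ∂P := by
  rw [lintegral_of_indepFun_map hU hV h hF]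
  refine lintegral_congr fun ω => ?_
  have hx : Measurable fun x : X => F (x, V ω) := hF.comp measurable_prodMk_right
  exact lintegral_map hx hU

/-- The law of the iterated Bessel process at time `t`. -/
theorem lintegral_iteratedBessel {d : ℕ} (hd : 1 ≤ d) (l : ℕ)
    {B : Fin (l + 1) → Fin d → ℝ≥0 → Ω → ℝ}
    (hBm : ∀ j i s, Measurable (B j i s)) (hB : ∀ j i, IsBrownianReal (B j i) P)
    (hBi : iIndepFun (fun (p : Fin (l + 1) × Fin d) ω (s : ℝ≥0) => B p.1 p.2 s ω) P)
    {t : ℝ≥0} (ht : 0 < t) {f : ℝ → ℝ≥0∞} (hf : Measurable f) :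
    ∫⁻ ω, f (iteratedBessel l B t ω) ∂P =
      ENNReal.ofReal (1 / (Real.Gamma ((d : ℝ) / 2) * 2 ^ ((d : ℝ) / 2 - 1))) ^ l *
        nestedIntegral d (fun u => ∫⁻ s, f s ∂besselLaw d u) l t := by
  induction l generalizing f with
  | zero =>
    rw [pow_zero, one_mul]
    exact lintegral_bessel hd (hBm 0) (hB 0)
      (hBi.precomp (g := fun i => (0, i)) fun i j h => by simpa using h) ht hf
  | succ l ih =>
    have hBi' : iIndepFun (fun (p : Fin (l + 1) × Fin d) ω (s : ℝ≥0) => B p.1.succ p.2 s ω) P :=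
      hBi.precomp (g := fun p : Fin (l + 1) × Fin d => (p.1.succ, p.2)) fun p q h => by
        simpa [Prod.ext_iff] using h
    have hIH := fun (f : ℝ → ℝ≥0∞) (hf : Measurable f) =>
      ih (B := fun j => B j.succ) (fun j => hBm j.succ) (fun j => hB j.succ) hBi' hf
    have hae := iteratedBessel_ae_eq_clock (B := fun j => B j.succ) (fun j => hB j.succ) t
    have hpos := ae_pos_of_lintegral_nestedIntegral
      (aemeasurable_iteratedBessel (B := fun j => B j.succ) (fun j => hBm j.succ)
        (fun j => hB j.succ) t) hIH
    set b₀ : Ω → Fin d → ℝ≥0 → ℝ := fun ω i s => B 0 i s ω with hb₀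
    set T : Ω → ℝ≥0 := fun ω => clock l (fun j i s => B j.succ i s ω) t with hT
    have hb₀m : Measurable b₀ := measurable_pi_lambda _ fun i => measurable_pi_lambda _ fun s =>
      hBm 0 i s
    have htail : Measurable fun ω (j : Fin (l + 1)) i (s : ℝ≥0) => B j.succ i s ω :=
      measurable_paths fun j => hBm j.succ
    have hTm : Measurable T := (measurable_clock l t).comp htail
    have hind : IndepFun b₀ T P :=
      (indepFun_head_tail hBm hBi).comp measurable_id (measurable_clock l t)
    have hcont : ∀ᵐ ω ∂P, ∀ i, Continuous fun s => B 0 i s ω :=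
      ae_all_iff.2 fun i => (hB 0 i).cont
    have hr : Measurable fun q : (Fin d → ℝ≥0 → ℝ) × ℝ≥0 => f (radius q.1 q.2) :=
      hf.comp (measurable_coe_nnreal_real.comp (measurable_radius measurable_fst measurable_snd))
    -- Conditioning on the inner clock, which is independent of the outermost process. Positivity of
    -- the clock is needed because `lintegral_bessel` covers only positive times.
    have hstep : ∫⁻ ω, f (iteratedBessel (l + 1) B t ω) ∂P =
        ∫⁻ ω, ∫⁻ s, f s ∂besselLaw d (iteratedBessel l (fun j => B j.succ) t ω) ∂P := by
      calc ∫⁻ ω, f (iteratedBessel (l + 1) B t ω) ∂P = ∫⁻ ω, f (radius (b₀ ω) (T ω)) ∂P := by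
            refine lintegral_congr_ae ?_
            filter_upwards [hcont, hae] with ω h1 h2
            rw [iteratedBessel, ← radius_eq_bessel h1, h2]
        _ = ∫⁻ ω, ∫⁻ ω', f (radius (b₀ ω') (T ω)) ∂P ∂P :=
            lintegral_of_indepFun hb₀m hTm hind hr
        _ = _ := by
            refine lintegral_congr_ae ?_
            filter_upwards [hae, hpos] with ω h1 h2
            rw [h1] at h2 ⊢
            rw [← lintegral_bessel hd (hBm 0) (hB 0)
              (hBi.precomp (g := fun i => (0, i)) fun i j h => by simpa using h) h2 hf]
            refine lintegral_congr_ae ?_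
            filter_upwards [hcont] with ω' h3
            rw [radius_eq_bessel h3]
    rw [hstep, hIH _ (measurable_lintegral_besselLaw d hf), pow_succ, mul_assoc]
    congr 1
    -- The new Bessel kernel sits at the inner end, whereas `nestedIntegral` unfolds from the outer
    -- end. Its normalizing constant is the additional factor of the power.
    rw [← nestedIntegral_kernel, ← nestedIntegral_const_mul d ENNReal.ofReal_ne_top]
    congr 1
    funext u
    rw [lintegral_besselLaw d _ (measurable_lintegral_besselLaw d hf)]

end IteratedLaw

/-! ### The joint law of the event count and the position -/

lemma position_eq_linePosition {Ω : Type*} (c : ℝ) (τ θ : ℕ → Ω → ℝ) (s : ℝ) (ω : Ω) :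
    position c τ θ s ω =
      linePosition c (eventCount τ s ω) s (fun k => τ k ω) (fun k => θ k ω) := by
  simp only [position, linePosition, epoch, Finset.sum_range_succ, add_sub_cancel_left]

lemma measurable_eventCount {Ω Z : Type*} [MeasurableSpace Z] {τ : ℕ → Ω → ℝ} {g : Z → Ω}
    (hτ : ∀ k, Measurable fun z => τ k (g z)) {s : Z → ℝ} (hs : Measurable s) :
    Measurable fun z => eventCount τ (s z) (g z) := by
  -- The count is a countable sum of indicators. For an infinite set `Set.ncard` is `0`, in
  -- agreement with `ENNReal.toReal ∞ = 0`.
  have h (z : Z) : eventCount τ (s z) (g z) =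
      ⌊(∑' j : ℕ,
        {j : ℕ | 1 ≤ j ∧ epoch τ j (g z) ≤ s z}.indicator (1 : ℕ → ℝ≥0∞) j).toReal⌋₊ := by
    rw [← tsum_subtype]
    simp only [Pi.one_apply]
    rw [ENNReal.tsum_set_one, eventCount, Set.ncard]
    cases {j : ℕ | 1 ≤ j ∧ epoch τ j (g z) ≤ s z}.encard <;> simp
  simp only [h]
  refine Nat.measurable_floor.comp (ENNReal.measurable_toReal.comp (Measurable.tsum fun j => ?_))
  have he : Measurable fun z => epoch τ j (g z) := by
    simp only [epoch]
    exact Finset.measurable_sum _ fun i _ => hτ i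
  have hS : MeasurableSet {z | 1 ≤ j ∧ epoch τ j (g z) ≤ s z} :=
    (MeasurableSet.const _).inter (measurableSet_le he hs)
  exact measurable_one.indicator hS

lemma measurable_position {Ω Z : Type*} [MeasurableSpace Z] (c : ℝ) {τ θ : ℕ → Ω → ℝ} {g : Z → Ω}
    (hτ : ∀ k, Measurable fun z => τ k (g z)) (hθ : ∀ k, Measurable fun z => θ k (g z))
    {s : Z → ℝ} (hs : Measurable s) :
    Measurable fun z => position c τ θ (s z) (g z) := by
  simp only [position_eq_linePosition]
  have h : Measurable fun q : ℕ × Z =>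
      linePosition c q.1 (s q.2) (fun k => τ k (g q.2)) (fun k => θ k (g q.2)) := by
    refine measurable_from_prod_countable_right fun k => ?_
    exact measurable_linePosition c k hs (measurable_pi_lambda _ hτ) (measurable_pi_lambda _ hθ)
  exact h.comp ((measurable_eventCount hτ hs).prodMk measurable_id)

lemma eventCount_eq_of_mem_countSet {Ω : Type*} {τ : ℕ → Ω → ℝ} {ω : Ω} (hτ : ∀ k, 0 < τ k ω)
    {n : ℕ} {s : ℝ} (h : (fun k => τ k ω) ∈ countSet n s) : eventCount τ s ω = n := by
  have hmono : StrictMono fun j => epoch τ j ω :=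
    strictMono_nat_of_lt_succ fun j => by simp [epoch, Finset.sum_range_succ, hτ j]
  have hS : {j : ℕ | 1 ≤ j ∧ epoch τ j ω ≤ s} = ((Finset.Icc 1 n : Finset ℕ) : Set ℕ) := by
    ext j
    simp only [Set.mem_ofPred_eq, Finset.coe_Icc, Set.mem_Icc]
    refine and_congr_right fun _ => ⟨fun hj => ?_, fun hj => (hmono.monotone hj).trans h.1⟩
    exact Nat.lt_succ_iff.1 (hmono.lt_iff_lt.1 (hj.trans_lt h.2))
  rw [eventCount, hS, Set.ncard_coe_finset]
  simp

lemma poissonWeight_pos {r : ℝ} (hr : 0 < r) (n : ℕ) {s : ℝ} (hs : 0 < s) :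
    0 < poissonWeight r n s := by
  rw [poissonWeight, if_pos hs.le]
  positivity

lemma tsum_poissonWeight {r : ℝ} (hr : 0 < r) {s : ℝ} (hs : 0 ≤ s) :
    ∑' n, ENNReal.ofReal (poissonWeight r n s) = 1 := by
  simp only [poissonWeight, if_pos hs]
  have h0 (n : ℕ) : 0 ≤ Real.exp (-(r * s)) * (r * s) ^ n / n.factorial := by positivity
  have h1 : HasSum (fun n : ℕ => Real.exp (-(r * s)) * (r * s) ^ n / n.factorial) 1 := by
    have := (NormedSpace.expSeries_div_hasSum_exp (r * s)).mul_left (Real.exp (-(r * s)))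
    rw [← congrFun Real.exp_eq_exp_ℝ, ← Real.exp_add, neg_add_cancel, Real.exp_zero] at this
    simpa only [mul_div_assoc] using this
  rw [← ENNReal.ofReal_tsum_of_nonneg h0 h1.summable, h1.tsum_eq, ENNReal.ofReal_one]

lemma ae_pos_expMeasure {r : ℝ} (hr : 0 < r) : ∀ᵐ x ∂expMeasure r, 0 < x := by
  have := isProbabilityMeasure_expMeasure hr
  have h := expMeasure_Ioi hr le_rfl
  rw [mul_zero, neg_zero, Real.exp_zero, ENNReal.ofReal_one] at h
  exact (prob_compl_eq_zero_iff measurableSet_Ioi).2 h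

lemma ae_pos_infinitePi_expMeasure {r : ℝ} (hr : 0 < r) :
    ∀ᵐ x ∂(Measure.infinitePi fun _ : ℕ => expMeasure r), ∀ k, 0 < x k := by
  have := isProbabilityMeasure_expMeasure hr
  refine ae_all_iff.2 fun k => ?_
  have h := measurePreserving_eval_infinitePi (fun _ : ℕ => expMeasure r) k
  exact h.quasiMeasurePreserving.ae (ae_pos_expMeasure hr)

lemma mem_countSet_unique {x : ℕ → ℝ} (hx : ∀ k, 0 < x k) {k n : ℕ} {s : ℝ}
    (hk : x ∈ countSet k s) (hn : x ∈ countSet n s) : k = n :=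
  (eventCount_eq_of_mem_countSet (τ := fun k (x : ℕ → ℝ) => x k) hx hk).symm.trans
    (eventCount_eq_of_mem_countSet (τ := fun k (x : ℕ → ℝ) => x k) hx hn)

lemma measurableSet_countSet (n : ℕ) (s : ℝ) : MeasurableSet (countSet n s) :=
  (measurableSet_countSet_uncurry n).preimage (measurable_prodMk_left (x := s))

/-- Almost surely finitely many events occur in finite time. -/
lemma ae_exists_mem_countSet {r : ℝ} (hr : 0 < r) {s : ℝ} (hs : 0 ≤ s) :
    ∀ᵐ x ∂(Measure.infinitePi fun _ : ℕ => expMeasure r), ∃ n, x ∈ countSet n s := by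
  have := isProbabilityMeasure_expMeasure hr
  set L := Measure.infinitePi fun _ : ℕ => expMeasure r
  have hcount (n : ℕ) : L (countSet n s) = ENNReal.ofReal (poissonWeight r n s) := by
    -- Speed and angle law are dummies: with `f = 1` only the probability of the count remains.
    have h := lintegral_linePosition 0 hr (Measure.dirac 0) n s (f := fun _ => 1) measurable_const
    simp only [lintegral_const, measure_univ, mul_one] at h
    rw [← h, ← lintegral_indicator_one (measurableSet_countSet n s)]
    rfl
  have hle : (fun x => ∑' n, (countSet n s).indicator (1 : (ℕ → ℝ) → ℝ≥0∞) x) ≤ᵐ[L] 1 := by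
    filter_upwards [ae_pos_infinitePi_expMeasure hr] with x hx
    by_cases h : ∃ n, x ∈ countSet n s
    · obtain ⟨n, hn⟩ := h
      rw [tsum_eq_single n fun k hk =>
        Set.indicator_of_notMem (fun h => hk (mem_countSet_unique hx h hn)) _]
      simp [hn]
    · push Not at h
      simp [h]
  have hint : ∫⁻ x, ∑' n, (countSet n s).indicator (1 : (ℕ → ℝ) → ℝ≥0∞) x ∂L = 1 := by
    rw [lintegral_tsum fun n =>
      (measurable_one.indicator (measurableSet_countSet n s)).aemeasurable]
    simp only [lintegral_indicator_one (measurableSet_countSet _ s), hcount]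
    exact tsum_poissonWeight hr hs
  have heq := ae_eq_of_ae_le_of_lintegral_le hle (by rw [hint]; exact ENNReal.one_ne_top)
    aemeasurable_one (by simp [hint])
  filter_upwards [heq] with x hx
  by_contra! h
  simp [h] at hx

/-- The joint law of the number of events and the position at a fixed time. -/
theorem lintegral_eventCount_position (c : ℝ) {r : ℝ} (hr : 0 < r) (α : Measure ℝ)
    [IsProbabilityMeasure α] {s : ℝ} (hs : 0 ≤ s) {F : ℕ → ℝ → ℝ≥0∞} (hF : ∀ n, Measurable (F n)) :
    ∫⁻ x, ∫⁻ y, F (eventCount (fun k (q : (ℕ → ℝ) × (ℕ → ℝ)) => q.1 k) s (x, y))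
        (position c (fun k q => q.1 k) (fun k q => q.2 k) s (x, y))
        ∂(Measure.infinitePi fun _ : ℕ => α) ∂(Measure.infinitePi fun _ : ℕ => expMeasure r) =
      ∑' n, ENNReal.ofReal (poissonWeight r n s) * ∫⁻ y, F n (s * y) ∂unitLaw c α n := by
  have := isProbabilityMeasure_expMeasure hr
  have hm (n : ℕ) : Measurable fun q : (ℕ → ℝ) × (ℕ → ℝ) =>
      (countSet n s).indicator (fun x => F n (linePosition c n s x q.2)) q.1 := by
    have : Measurable ((Prod.fst ⁻¹' countSet n s).indicator
        fun q : (ℕ → ℝ) × (ℕ → ℝ) => F n (linePosition c n s q.1 q.2)) :=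
      ((hF n).comp (measurable_linePosition c n measurable_const measurable_fst
        measurable_snd)).indicator (measurable_fst (measurableSet_countSet n s))
    exact this
  calc _ = ∫⁻ x, ∫⁻ y, ∑' n, (countSet n s).indicator (fun x => F n (linePosition c n s x y)) x
        ∂(Measure.infinitePi fun _ : ℕ => α) ∂(Measure.infinitePi fun _ : ℕ => expMeasure r) := by
        refine lintegral_congr_ae ?_
        filter_upwards [ae_pos_infinitePi_expMeasure hr, ae_exists_mem_countSet hr hs]
          with x hx ⟨n, hn⟩
        refine lintegral_congr fun y => ?_
        rw [tsum_eq_single n fun k hk =>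
          Set.indicator_of_notMem (fun h => hk (mem_countSet_unique hx h hn)) _,
          Set.indicator_of_mem hn, position_eq_linePosition,
          eventCount_eq_of_mem_countSet (τ := fun k (q : (ℕ → ℝ) × (ℕ → ℝ)) => q.1 k)
            (ω := (x, y)) hx hn]
    _ = ∫⁻ x, ∑' n, ∫⁻ y, (countSet n s).indicator (fun x => F n (linePosition c n s x y)) x
        ∂(Measure.infinitePi fun _ : ℕ => α) ∂(Measure.infinitePi fun _ : ℕ => expMeasure r) := by
        refine lintegral_congr fun x => lintegral_tsum fun n => ?_
        exact ((hm n).comp measurable_prodMk_left).aemeasurable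
    _ = _ := by
        rw [lintegral_tsum fun n => (hm n).lintegral_prod_right'.aemeasurable]
        exact tsum_congr fun n => lintegral_linePosition c hr α n s (hF n)

/-! ### Conditioning on the event count and the clock -/

/-- The law of the motion at time `s`, given the number `n` of events up to that time, as a kernel
in `(n, s)`. -/
def scaledUnitLaw (c : ℝ) (α : Measure ℝ) [IsProbabilityMeasure α] : Kernel (ℕ × ℝ≥0) ℝ where
  toFun p := (unitLaw c α p.1).map fun y => (p.2 : ℝ) * y
  measurable' := by
    refine measurable_from_prod_countable_right fun n => ?_
    refine Measure.measurable_of_measurable_coe _ fun A hA => ?_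
    have h (s : ℝ≥0) : (unitLaw c α n).map (fun y => (s : ℝ) * y) A =
        unitLaw c α n (Prod.mk s ⁻¹' {q : ℝ≥0 × ℝ | (q.1 : ℝ) * q.2 ∈ A}) := by
      rw [Measure.map_apply (by fun_prop) hA]
      rfl
    simp only [h]
    refine measurable_measure_prodMk_left ?_
    exact (by fun_prop : Measurable fun q : ℝ≥0 × ℝ => (q.1 : ℝ) * q.2) hA

lemma scaledUnitLaw_apply (c : ℝ) (α : Measure ℝ) [IsProbabilityMeasure α] (n : ℕ) (s : ℝ≥0) :
    scaledUnitLaw c α (n, s) = (unitLaw c α n).map fun y => (s : ℝ) * y := rfl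

instance isMarkovKernel_scaledUnitLaw (c : ℝ) (α : Measure ℝ) [IsProbabilityMeasure α] :
    IsMarkovKernel (scaledUnitLaw c α) :=
  ⟨fun _ => Measure.isProbabilityMeasure_map (by fun_prop)⟩

section Conditioning

variable {Ω : Type*} [MeasurableSpace Ω] {P : Measure Ω} [IsProbabilityMeasure P]
  {τ θ : ℕ → Ω → ℝ} {T : Ω → ℝ≥0} {r c : ℝ} {α : Measure ℝ} [IsProbabilityMeasure α]

/-- The joint law of the number of events, the clock and the position at the time shown by an
independent clock. -/
theorem lintegral_eventCount_clock_position (hr : 0 < r)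
    (hτm : ∀ k, Measurable (τ k)) (hθm : ∀ k, Measurable (θ k)) (hTm : Measurable T)
    (hτ : ∀ k, HasLaw (τ k) (expMeasure r) P) (hτi : iIndepFun τ P)
    (hθ : ∀ k, HasLaw (θ k) α P) (hθi : iIndepFun θ P)
    (hτθ : IndepFun (fun ω k => τ k ω) (fun ω k => θ k ω) P)
    (hT : IndepFun (fun ω => ((fun k => τ k ω), (fun k => θ k ω))) T P)
    {G : (ℕ × ℝ≥0) × ℝ → ℝ≥0∞} (hG : Measurable G) :
    ∫⁻ ω, G ((eventCount τ (T ω) ω, T ω), position c τ θ (T ω) ω) ∂P =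
      ∫⁻ ω, ∑' n, ENNReal.ofReal (poissonWeight r n (T ω)) *
        ∫⁻ z, G ((n, T ω), z) ∂scaledUnitLaw c α (n, T ω) ∂P := by
  have := isProbabilityMeasure_expMeasure hr
  have hτs : Measurable fun ω k => τ k ω := measurable_pi_lambda _ hτm
  have hθs : Measurable fun ω k => θ k ω := measurable_pi_lambda _ hθm
  have hlaw : P.map (fun ω => ((fun k => τ k ω), (fun k => θ k ω))) =
      (Measure.infinitePi fun _ : ℕ => expMeasure r).prod (Measure.infinitePi fun _ : ℕ => α) := by
    rw [(indepFun_iff_map_prod_eq_prod_map_map hτs.aemeasurable hθs.aemeasurable).1 hτθ,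
      (iIndepFun.hasLaw_infinitePi hτ hτi hτs.aemeasurable).map_eq,
      (iIndepFun.hasLaw_infinitePi hθ hθi hθs.aemeasurable).map_eq]
  obtain ⟨H, hH⟩ : ∃ H : (ℕ → ℝ) × (ℕ → ℝ) → ℝ≥0 → ℝ≥0∞, ∀ q s, H q s =
      G ((eventCount (fun k (q : (ℕ → ℝ) × (ℕ → ℝ)) => q.1 k) s q, s),
        position c (fun k (q : (ℕ → ℝ) × (ℕ → ℝ)) => q.1 k) (fun k q => q.2 k) s q) :=
    ⟨_, fun _ _ => rfl⟩
  have hF : Measurable fun q : ((ℕ → ℝ) × (ℕ → ℝ)) × ℝ≥0 => H q.1 q.2 := by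
    have h1 : Measurable fun q : ((ℕ → ℝ) × (ℕ → ℝ)) × ℝ≥0 =>
        eventCount (fun k (q : (ℕ → ℝ) × (ℕ → ℝ)) => q.1 k) q.2 q.1 :=
      measurable_eventCount (by fun_prop) (by fun_prop)
    have h2 : Measurable fun q : ((ℕ → ℝ) × (ℕ → ℝ)) × ℝ≥0 =>
        position c (fun k (q : (ℕ → ℝ) × (ℕ → ℝ)) => q.1 k) (fun k q => q.2 k) q.2 q.1 :=
      measurable_position c (by fun_prop) (by fun_prop) (by fun_prop)
    simp only [hH]
    exact hG.comp ((h1.prodMk measurable_snd).prodMk h2)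
  have hseq (ω : Ω) : G ((eventCount τ (T ω) ω, T ω), position c τ θ (T ω) ω) =
      H (fun k => τ k ω, fun k => θ k ω) (T ω) := by
    rw [hH]
    rfl
  have hFT := lintegral_of_indepFun_map (hτs.prodMk hθs) hTm hT hF
  rw [hlaw] at hFT
  rw [lintegral_congr hseq, hFT]
  refine lintegral_congr fun ω => ?_
  have hFω : Measurable fun q => H q (T ω) := hF.comp measurable_prodMk_right
  rw [lintegral_prod _ hFω.aemeasurable]
  simp only [hH]
  have hGn (n : ℕ) : Measurable fun z => G ((n, T ω), z) := hG.comp measurable_prodMk_left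
  rw [lintegral_eventCount_position c hr α (T ω).coe_nonneg (F := fun n z => G ((n, T ω), z)) hGn]
  refine tsum_congr fun n => ?_
  rw [scaledUnitLaw_apply, lintegral_map (hGn n) (by fun_prop)]

/-- Given `n` events up to a positive time `s` shown by an independent clock, the position has the
law of the motion at time `s` with `n` changes of direction. -/
theorem condDistrib_position_ae_eq (hr : 0 < r)
    (hτm : ∀ k, Measurable (τ k)) (hθm : ∀ k, Measurable (θ k)) (hTm : Measurable T)
    (hτ : ∀ k, HasLaw (τ k) (expMeasure r) P) (hτi : iIndepFun τ P)
    (hθ : ∀ k, HasLaw (θ k) α P) (hθi : iIndepFun θ P)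
    (hτθ : IndepFun (fun ω k => τ k ω) (fun ω k => θ k ω) P)
    (hT : IndepFun (fun ω => ((fun k => τ k ω), (fun k => θ k ω))) T P)
    (hpos : ∀ᵐ ω ∂P, 0 < T ω) (n : ℕ) :
    ∀ᵐ s ∂P.map T, condDistrib (fun ω => position c τ θ (T ω) ω)
      (fun ω => (eventCount τ (T ω) ω, T ω)) P (n, s) = scaledUnitLaw c α (n, s) := by
  have key {G : (ℕ × ℝ≥0) × ℝ → ℝ≥0∞} (hG : Measurable G) :=
    lintegral_eventCount_clock_position (c := c) hr hτm hθm hTm hτ hτi hθ hθi hτθ hT hG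
  have hTr : Measurable fun ω => (T ω : ℝ) := measurable_coe_nnreal_real.comp hTm
  have hNT : Measurable fun ω => (eventCount τ (T ω) ω, T ω) :=
    (measurable_eventCount (g := id) hτm hTr).prodMk hTm
  have hX : Measurable fun ω => position c τ θ (T ω) ω :=
    measurable_position c (g := id) hτm hθm hTr
  have hjoint : P.map (fun ω => ((eventCount τ (T ω) ω, T ω), position c τ θ (T ω) ω)) =
      P.map (fun ω => (eventCount τ (T ω) ω, T ω)) ⊗ₘ scaledUnitLaw c α := by
    refine Measure.ext_of_lintegral _ fun G hG => ?_
    have hG' : Measurable fun p : ℕ × ℝ≥0 => ∫⁻ z, G (p, z) ∂scaledUnitLaw c α p :=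
      hG.lintegral_kernel_prod_right'
    rw [lintegral_map hG (hNT.prodMk hX), Measure.lintegral_compProd hG, lintegral_map hG' hNT,
      key hG]
    refine Eq.trans ?_ (key (G := fun q => ∫⁻ z, G (q.1, z) ∂scaledUnitLaw c α q.1)
      (hG'.comp measurable_fst)).symm
    simp only [lintegral_const, measure_univ, mul_one]
  have hcond := condDistrib_ae_eq_of_measure_eq_compProd _ hX.aemeasurable hjoint
  -- The exceptional null set `S` of pairs has mass `E ∑_k p_k(T) 1_S(k, T) = 0`, where `p_k` is the
  -- Poisson weight. Since `p_n(T) > 0`, the section of `S` at `n` is null for the law of `T`.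
  obtain ⟨S, hsub, hSm, hS⟩ := exists_measurable_superset_of_null (ae_iff.1 hcond)
  have hind : Measurable (S.indicator (1 : ℕ × ℝ≥0 → ℝ≥0∞)) := measurable_one.indicator hSm
  have h0 : ∫⁻ ω, ∑' k, ENNReal.ofReal (poissonWeight r k (T ω)) *
      S.indicator 1 (k, T ω) ∂P = 0 := by
    have h := key (G := fun q => S.indicator 1 q.1) (hind.comp measurable_fst)
    simp only [lintegral_const, measure_univ, mul_one] at h
    rw [← h, ← lintegral_map hind hNT, lintegral_indicator_one hSm, hS]
  have hmeas : Measurable fun ω => ∑' k, ENNReal.ofReal (poissonWeight r k (T ω)) *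
      S.indicator (1 : ℕ × ℝ≥0 → ℝ≥0∞) (k, T ω) :=
    Measurable.tsum fun k => (((measurable_poissonWeight r k).comp hTr).ennreal_ofReal).mul
      (hind.comp (measurable_const.prodMk hTm))
  rw [lintegral_eq_zero_iff hmeas] at h0
  have hSn : MeasurableSet {s : ℝ≥0 | (n, s) ∉ S} := (measurable_prodMk_left hSm).compl
  have hnotMem : ∀ᵐ s ∂P.map T, (n, s) ∉ S := by
    rw [ae_map_iff hTm.aemeasurable hSn]
    filter_upwards [h0, hpos] with ω h1 h2 h3
    have h4 := ENNReal.tsum_eq_zero.1 h1 n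
    rw [Set.indicator_of_mem h3, Pi.one_apply, mul_one, ENNReal.ofReal_eq_zero] at h4
    exact absurd (poissonWeight_pos hr n h2) h4.not_gt
  filter_upwards [hnotMem] with s hs
  by_contra hne
  exact hs (hsub hne)

lemma lawFixedCount_congr {T' : Ω → ℝ≥0} (h : T =ᵐ[P] T') (c : ℝ) (τ θ : ℕ → Ω → ℝ) (n : ℕ) :
    lawFixedCount P c τ θ T n = lawFixedCount P c τ θ T' n := by
  rw [lawFixedCount, lawFixedCount, Measure.map_congr h,
    condDistrib_congr (Y' := fun ω => position c τ θ (T' ω) ω)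
      (X' := fun ω => (eventCount τ (T' ω) ω, T' ω))]
  · filter_upwards [h] with ω hω
    rw [hω]
  · filter_upwards [h] with ω hω
    rw [hω]

/-- The law of the motion at an independent random time for a fixed number of events. -/
theorem lawFixedCount_apply (hr : 0 < r)
    (hτm : ∀ k, Measurable (τ k)) (hθm : ∀ k, Measurable (θ k)) (hTm : Measurable T)
    (hτ : ∀ k, HasLaw (τ k) (expMeasure r) P) (hτi : iIndepFun τ P)
    (hθ : ∀ k, HasLaw (θ k) α P) (hθi : iIndepFun θ P)
    (hτθ : IndepFun (fun ω k => τ k ω) (fun ω k => θ k ω) P)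
    (hT : IndepFun (fun ω => ((fun k => τ k ω), (fun k => θ k ω))) T P)
    (hpos : ∀ᵐ ω ∂P, 0 < T ω) (n : ℕ) {A : Set ℝ} (hA : MeasurableSet A) :
    lawFixedCount P c τ θ T n A =
      ∫⁻ ω, ∫⁻ y, A.indicator 1 ((T ω : ℝ) * y) ∂unitLaw c α n ∂P := by
  have hκ (κ : Kernel (ℕ × ℝ≥0) ℝ) : Measurable fun s : ℝ≥0 => κ (n, s) :=
    κ.measurable.comp measurable_prodMk_left
  have hκA : Measurable fun s : ℝ≥0 => scaledUnitLaw c α (n, s) A :=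
    (Measure.measurable_coe hA).comp (hκ _)
  have hone : Measurable (A.indicator (1 : ℝ → ℝ≥0∞)) := measurable_one.indicator hA
  rw [lawFixedCount, Measure.bind_apply hA (hκ _).aemeasurable]
  rw [lintegral_congr_ae (g := fun s => scaledUnitLaw c α (n, s) A)]
  · rw [lintegral_map hκA hTm]
    refine lintegral_congr fun ω => ?_
    rw [← lintegral_indicator_one hA, scaledUnitLaw_apply, lintegral_map hone (by fun_prop)]
  · filter_upwards [condDistrib_position_ae_eq (c := c) hr hτm hθm hTm hτ hτi hθ hθi hτθ hT hpos n]
      with s hs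
    rw [hs]

/-- The iterated process is only almost surely equal to a measurable variable; measurability and
independence are required of that version `T'` alone. -/
lemma lawFixedCount_apply_of_ae_eq {T' : Ω → ℝ≥0} (hTT' : T =ᵐ[P] T') (hr : 0 < r)
    (hτm : ∀ k, Measurable (τ k)) (hθm : ∀ k, Measurable (θ k)) (hTm : Measurable T')
    (hτ : ∀ k, HasLaw (τ k) (expMeasure r) P) (hτi : iIndepFun τ P)
    (hθ : ∀ k, HasLaw (θ k) α P) (hθi : iIndepFun θ P)
    (hτθ : IndepFun (fun ω k => τ k ω) (fun ω k => θ k ω) P)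
    (hT : IndepFun (fun ω => ((fun k => τ k ω), (fun k => θ k ω))) T' P)
    (hpos : ∀ᵐ ω ∂P, 0 < T ω) (n : ℕ) {A : Set ℝ} (hA : MeasurableSet A) :
    lawFixedCount P c τ θ T n A =
      ∫⁻ ω, ∫⁻ y, A.indicator 1 ((T ω : ℝ) * y) ∂unitLaw c α n ∂P := by
  have hpos' : ∀ᵐ ω ∂P, 0 < T' ω := by
    filter_upwards [hTT', hpos] with ω h1 h2
    rwa [← h1]
  rw [lawFixedCount_congr hTT',
    lawFixedCount_apply hr hτm hθm hTm hτ hτi hθ hθi hτθ hT hpos' n hA]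
  refine lintegral_congr_ae ?_
  filter_upwards [hTT'] with ω hω
  rw [hω]

end Conditioning

/-! ### Assembly of the density -/

lemma measurable_betaGaussIntegral (d : ℕ) (v c : ℝ) :
    Measurable fun p : ℝ × ℝ => betaGaussIntegral d v c p.1 p.2 := by
  unfold betaGaussIntegral
  exact Measurable.lintegral_prod_right' (f := fun q : (ℝ × ℝ) × ℝ => ENNReal.ofReal
    (q.2 ^ ((d : ℝ) / 2 - 1) * (1 - q.2) ^ (v - (d : ℝ) / 2) *
      (Real.exp (-q.1.1 ^ 2 / (2 * c ^ 2 * q.1.2 * q.2)) / (√(2 * Real.pi * q.1.2 * q.2) * c))))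
    (by fun_prop)

/-- The Bessel law at the innermost time is absorbed by the product identity, and Tonelli's theorem
moves the integral over `x` outside the nested ones. -/
lemma nestedIntegral_besselLaw_unitLaw {c : ℝ} (hc : 0 < c) (m : Fin 2)
    [IsProbabilityMeasure (angleMeasure ((m : ℕ) : ℝ))] {d n : ℕ} (hd : 1 ≤ d)
    (hv : (d : ℝ) / 2 - 1 < vParam m n) (l : ℕ) {t : ℝ} (ht : 0 < t) {A : Set ℝ}
    (hA : MeasurableSet A) :
    nestedIntegral d (fun u => ∫⁻ s, ∫⁻ y, A.indicator 1 (s * y)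
        ∂unitLaw c (angleMeasure ((m : ℕ) : ℝ)) n ∂besselLaw d u) l t =
      ENNReal.ofReal (1 / beta ((d : ℝ) / 2) (vParam m n - (d : ℝ) / 2 + 1)) *
        ∫⁻ x in A, nestedIntegral d (betaGaussIntegral d (vParam m n) c x) l t := by
  rw [nestedIntegral_congr d (fun s hs => lintegral_besselWeight_unitLaw hc m hd hv hs
      (measurable_one.indicator hA)) l ht,
    nestedIntegral_const_mul d ENNReal.ofReal_ne_top,
    ← nestedIntegral_lintegral _ d (measurable_betaGaussIntegral d (vParam m n) c)]
  congr 2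
  funext u
  rw [← lintegral_indicator hA]
  refine lintegral_congr fun x => ?_
  by_cases hx : x ∈ A <;> simp [hx]

end

theorem theorem7 {Ω : Type*} [MeasurableSpace Ω] (P : Measure Ω) [IsProbabilityMeasure P]
    (m : Fin 2) (c r : ℝ) (hc : 0 < c) (hr : 0 < r)
    (d l n : ℕ) (hd : 1 ≤ d) (hn : 1 ≤ n) (hv : (d : ℝ) / 2 - 1 < vParam m n)
    (t : ℝ≥0) (ht : 0 < t)
    -- waiting times of the Poisson process, angles, and the Brownian motions behind the clock
    (τ θ : ℕ → Ω → ℝ) (B : Fin (l + 1) → Fin d → ℝ≥0 → Ω → ℝ)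
    (hτm : ∀ k, Measurable (τ k)) (hθm : ∀ k, Measurable (θ k))
    (hBm : ∀ j i s, Measurable (B j i s))
    (hτ : ∀ k, HasLaw (τ k) (expMeasure r) P) (hτi : iIndepFun τ P)
    (hθ : ∀ k, HasLaw (θ k) (angleMeasure (m : ℕ)) P) (hθi : iIndepFun θ P)
    (hB : ∀ j i, IsBrownianReal (B j i) P)
    (hBi : iIndepFun (fun (p : Fin (l + 1) × Fin d) ω (s : ℝ≥0) => B p.1 p.2 s ω) P)
    -- the angles are independent of the Poisson process, and the clock is independent of both
    (hτθ : IndepFun (fun ω k => τ k ω) (fun ω k => θ k ω) P)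
    (hclock : IndepFun (fun ω => ((fun k => τ k ω), (fun k => θ k ω)))
      (fun ω j i (s : ℝ≥0) => B j i s ω) P) :
    lawFixedCount P c τ θ (iteratedBessel l B t) n =
      volume.withDensity fun x : ℝ =>
        ENNReal.ofReal (1 / beta ((d : ℝ) / 2) (vParam m n - (d : ℝ) / 2 + 1)) *
        ENNReal.ofReal (1 / (Real.Gamma ((d : ℝ) / 2) * 2 ^ ((d : ℝ) / 2 - 1)) ^ l) *
        nestedIntegral d (betaGaussIntegral d (vParam m n) c x) l t := by
  -- The angle law has mass one because it is the law of `θ 0`; no Gamma integral is evaluated.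
  have hα : IsProbabilityMeasure (angleMeasure ((m : ℕ) : ℝ)) := by
    rw [← (hθ 0).map_eq]
    exact Measure.isProbabilityMeasure_map (hθm 0).aemeasurable
  obtain ⟨T, hTm, hae, hT⟩ : ∃ T : Ω → ℝ≥0, Measurable T ∧ iteratedBessel l B t =ᵐ[P] T ∧
      IndepFun (fun ω => ((fun k => τ k ω), (fun k => θ k ω))) T P :=
    ⟨_, (measurable_clock l t).comp (measurable_paths hBm), iteratedBessel_ae_eq_clock hB t,
      hclock.comp (φ := fun q => q) measurable_id (measurable_clock l t)⟩
  have hlaw := fun (f : ℝ → ℝ≥0∞) (hf : Measurable f) =>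
    lintegral_iteratedBessel hd l hBm hB hBi ht hf
  have hpos := ae_pos_of_lintegral_nestedIntegral (aemeasurable_iteratedBessel hBm hB t) hlaw
  refine Measure.ext fun A hA => ?_
  have hmeas : Measurable fun x =>
      nestedIntegral d (betaGaussIntegral d (vParam m n) c x) l (t : ℝ) :=
    measurable_nestedIntegral d (g := betaGaussIntegral d (vParam m n) c)
      (measurable_betaGaussIntegral d (vParam m n) c) l t
  have hf : Measurable fun u : ℝ => ∫⁻ y, A.indicator (1 : ℝ → ℝ≥0∞) (u * y)
      ∂unitLaw c (angleMeasure ((m : ℕ) : ℝ)) n := by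
    have h1 : Measurable (A.indicator (1 : ℝ → ℝ≥0∞)) := measurable_one.indicator hA
    exact Measurable.lintegral_prod_right' (f := fun q : ℝ × ℝ =>
      A.indicator (1 : ℝ → ℝ≥0∞) (q.1 * q.2)) (h1.comp (by fun_prop))
  have hΓ : 0 ≤ 1 / (Real.Gamma ((d : ℝ) / 2) * 2 ^ ((d : ℝ) / 2 - 1)) := by positivity
  rw [lawFixedCount_apply_of_ae_eq hae hr hτm hθm hTm hτ hτi hθ hθi hτθ hT hpos n hA,
    withDensity_apply _ hA, lintegral_const_mul _ hmeas, hlaw _ hf,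
    nestedIntegral_besselLaw_unitLaw hc m hd hv l (by exact_mod_cast ht) hA,
    ← ENNReal.ofReal_pow hΓ, one_div_pow]
  ring
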